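/- Let $n\ge 0$, $\mathcal H=(\mathbb C^2)^{\otimes n}$, and let $\mathsf{SU}(2)$ act on $\mathcal H$ by $Q(U)=U^{\otimes n}$. Let $\{|w\rangle\}=\{|\lambda,q,t\rangle\}$ be a Schur basis of $\mathcal H$: an orthonormal basis realizing the decomposition $\mathcal H\cong\bigoplus_{\lambda}Q_\lambda\otimes\mathbb C^{m_\lambda}$ over the partitions $\lambda=[\lambda_1,\lambda_2]$ of $n$ of length at most two, where $Q_\lambda$ is the irreducible representation of $\mathsf{SU}(2)$ of spin $s_\lambda=(\lambda_1-\lambda_2)/2$, such that $U^{\otimes n}$ acts on $|\lambda,q,t\rangle$ through the label $q$ alone (as on $Q_\lambda$) and $|\lambda,q,t\rangle$ is an eigenvector of $J_z=\frac12\sum_i Z_i$ with eigenvalue $s_\lambda-q$, $q=0,\dots,2s_\lambda$. Let $U$ be drawn from the Haar measure of $\mathsf{SU}(2)$ or, more generally, from a probability measure on $\mathsf{SU}(2)$ for which $Q(U)$ is a 3-design over $\mathsf{SU}(2)$, i.e. $\mathbb E\big[Q(U)^{\dagger\otimes 3}AQ(U)^{\otimes 3}\big]$ agrees with the Haar average for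 every operator $A$ on $\mathcal H^{\otimes 3}$. With $\Pi_w=|w\rangle\langle w|$ let $$\mathcal M(X)=\mathbb E_U\sum_w \mathrm{Tr}\big[X\,Q(U)^\dagger\Pi_wQ(U)\big]\,Q(U)^\dagger\Pi_wQ(U)$$ be the measurement channel, let $\mathcal M^{-1}$ be its Moore–Penrose pseudoinverse with respect to the Hilbert–Schmidt inner product, and let the image of $\mathcal M$ be called the visible space. For an operator $O$ on $\mathcal H$ let $\hat o=\mathrm{Tr}\big[\mathcal M^{-1}(Q(U)^\dagger\Pi_wQ(U))\,O\big]$ be the single-shot estimator, where, for a density operator $\rho$ on $\mathcal H$, the outcome $w$ has conditional probability $\mathrm{Tr}[\rho\, Q(U)^\dagger\Pi_wQ(U)]$ given $U$. If $O$ is permutation-invariant, i.e. commutes with all permutations of the $n$ qubits, then $O$ lies in the visible space, and for every density operator $\rho$ the estimator is unbiased, $\mathbb E[\hat o]=\mathrm{Tr}[\rho O]$, with variance $$\mathrm{Var}[\hat o]=\mathbb E\,\big|\hat o-\mathbb E[\hat o]\big|^2\le\frac43\,(n+1)^4\,\|O\|_\infty^2 ,$$ where $\|\cdot\|_\infty$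 is the spectral norm. -/

import Mathlib

namespace SU2Shadows

noncomputable section

open MeasureTheory Matrix
open scoped ComplexOrder

/-! ### The group `SU(2)`: topology, Borel sets, Haar probability measure -/

/-- The group `SU(2)`. -/
abbrev SU2 : Type := Matrix.specialUnitaryGroup (Fin 2) ℂ

instance : IsTopologicalGroup SU2 where
  continuous_inv := by
    refine Continuous.subtype_mk ?_ _
    exact continuous_star.comp continuous_subtype_val

open scoped Matrix.Norms.L2Operator in
instance : CompactSpace SU2 := by
  refine isCompact_iff_compactSpace.mp ?_
  refine Metric.isCompact_of_isClosed_isBounded ?_ ?_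
  · have h : ((Matrix.specialUnitaryGroup (Fin 2) ℂ : Submonoid (Matrix (Fin 2) (Fin 2) ℂ)) :
        Set (Matrix (Fin 2) (Fin 2) ℂ)) =
        {A | A * star A = 1} ∩ {A | A.det = 1} := by
      ext A
      simp [Matrix.mem_specialUnitaryGroup_iff, Matrix.mem_unitaryGroup_iff]
    rw [h]
    refine IsClosed.inter ?_ ?_
    · exact isClosed_eq (continuous_id.mul continuous_star) continuous_const
    · exact isClosed_eq (Continuous.matrix_det continuous_id) continuous_const
  · refine (Metric.isBounded_closedBall (x := (0 : Matrix (Fin 2) (Fin 2) ℂ)) (r := 1)).subset ?_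
    intro A hA
    have hU : A ∈ Matrix.unitaryGroup (Fin 2) ℂ :=
      (Matrix.mem_specialUnitaryGroup_iff.mp hA).1
    rw [mem_closedBall_zero_iff]
    exact (CStarRing.norm_of_mem_unitary hU).le

instance : MeasurableSpace SU2 := borel SU2

instance : BorelSpace SU2 := ⟨rfl⟩

/-- The Haar probability measure of `SU(2)`. -/
def haarSU2 : Measure SU2 := Measure.haarMeasure ⊤

/-! ### `n` qubits -/

/-- Labels of the computational basis of `n` qubits. -/
abbrev Bits (n : ℕ) : Type := Fin n → Fin 2

/-- The Hilbert space `(ℂ²)^{⊗ n}` of `n` qubits, in computational-basis coordinates. -/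
abbrev Qubits (n : ℕ) : Type := EuclideanSpace ℂ (Bits n)

/-- Linear operators on `n` qubits, as matrices in the computational basis. -/
abbrev Op (n : ℕ) : Type := Matrix (Bits n) (Bits n) ℂ

/-- The `m`-fold tensor (Kronecker) power `A^{⊗ m}` of a matrix. -/
def tensorPow {d : Type*} (m : ℕ) (A : Matrix d d ℂ) : Matrix (Fin m → d) (Fin m → d) ℂ :=
  Matrix.of fun x y => ∏ i, A (x i) (y i)

/-- The tensor representation `Q(U) = U^{⊗ n}` of `SU(2)` on `n` qubits. -/
def Q (n : ℕ) (U : SU2) : Op n := tensorPow n U.1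

/-- The action of a permutation `π` on `n` qubits,
`P(π) |x₁ … xₙ⟩ = |x_{π⁻¹(1)} … x_{π⁻¹(n)}⟩`. -/
def permOp (n : ℕ) (π : Equiv.Perm (Fin n)) : Op n :=
  Matrix.of fun x y => if x = y ∘ π.symm then 1 else 0

/-- An operator is permutation-invariant if it commutes with all qubit permutations. -/
def IsPermInvariant {n : ℕ} (O : Op n) : Prop := ∀ π, Commute (permOp n π) O

/-- A density matrix. -/
def IsState {n : ℕ} (ρ : Op n) : Prop := ρ.PosSemidef ∧ ρ.trace = 1

/-- The spectral norm of an operator on `n` qubits. -/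
def opNorm {n : ℕ} (O : Op n) : ℝ := ‖Matrix.toEuclideanCLM (𝕜 := ℂ) O‖

/-- The generator `J_z = ½ ∑ᵢ Zᵢ` of the torus of `SU(2)`, acting on `n` qubits. -/
def Jz (n : ℕ) : Op n :=
  Matrix.diagonal fun x => ∑ i, if x i = 0 then (1 / 2 : ℂ) else -(1 / 2)

/-! ### The Schur basis -/

/-- Labels `(λ, q, t)` of a Schur basis.  The partition `λ = [n - k, k]` is recorded by
`k ≤ n / 2`, its spin being `s = (n - 2 k) / 2`; the label `q` takes `2 s + 1 = n - 2 k + 1` values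
(the number of semistandard tableaux of shape `λ` in two letters); the multiplicity label `t` runs
over a set `T k` (such as the standard tableaux of shape `λ`). -/
abbrev SchurIndex (n : ℕ) (T : Fin (n / 2 + 1) → Type) : Type :=
  Σ k : Fin (n / 2 + 1), Fin (n - 2 * k.1 + 1) × T k

/-- `b` is a Schur basis: an orthonormal basis `|λ, q, t⟩` realizing
`(ℂ²)^{⊗ n} ≅ ⨁_λ Q_λ ⊗ ℂ^{m_λ}`, i.e. `U^{⊗ n}` acts on `|λ, q, t⟩` through matrices `D_λ(U)` in
the label `q` alone, and consisting of weight vectors: `J_z |λ, q, t⟩ = (s_λ - q) |λ, q, t⟩`.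
(A representation of `SU(2)` of dimension `2 s + 1` with the weights `s, s - 1, …, -s` is the
irreducible one of spin `s`, so that `D_λ` is the spin-`s_λ` irrep in a weight basis.) -/
structure IsSchurBasis (n : ℕ) (T : Fin (n / 2 + 1) → Type) [∀ k, Fintype (T k)]
    (b : OrthonormalBasis (SchurIndex n T) ℂ (Qubits n)) : Prop where
  tensor_action : ∃ D : (k : Fin (n / 2 + 1)) → SU2 →
      Matrix (Fin (n - 2 * k.1 + 1)) (Fin (n - 2 * k.1 + 1)) ℂ,
    ∀ U k q t, Matrix.toEuclideanCLM (𝕜 := ℂ) (Q n U) (b ⟨k, q, t⟩) =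
      ∑ q', D k U q' q • b ⟨k, q', t⟩
  weight : ∀ k q t, Matrix.toEuclideanCLM (𝕜 := ℂ) (Jz n) (b ⟨k, q, t⟩) =
    (((n : ℂ) - 2 * (k : ℕ)) / 2 - (q : ℕ)) • b ⟨k, q, t⟩

/-! ### Unitary 3-designs over `SU(2)` -/

/-- The third moment operator `A ↦ 𝔼_{U ∼ ν} (Q(U)^{⊗ 3})† A Q(U)^{⊗ 3}` of an ensemble `ν`. -/
def thirdMoment (n : ℕ) (ν : Measure SU2)
    (A : Matrix (Fin 3 → Bits n) (Fin 3 → Bits n) ℂ) :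
    Matrix (Fin 3 → Bits n) (Fin 3 → Bits n) ℂ :=
  Matrix.of fun x y => ∫ U, ((tensorPow 3 (Q n U))ᴴ * A * tensorPow 3 (Q n U)) x y ∂ν

/-- The ensemble `U^{⊗ n}`, `U ∼ ν`, is a 3-design over `SU(2)`: its third moments are those of the
Haar measure.  (In particular, the Haar measure itself is one.) -/
def IsThreeDesign (n : ℕ) (ν : Measure SU2) : Prop :=
  ∀ A, thirdMoment n ν A = thirdMoment n haarSU2 A

/-! ### Classical shadows -/

section Protocol

variable {n : ℕ} {ι : Type*} [Fintype ι]

/-- The snapshot `Q(U)† |w⟩⟨w| Q(U)` attached to the unitary `U` and the outcome `w` of a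
measurement in the orthonormal basis `b`. -/
def snapshot (b : OrthonormalBasis ι ℂ (Qubits n)) (U : SU2) (w : ι) : Op n :=
  (Q n U)ᴴ * Matrix.vecMulVec (b w).ofLp (star (b w).ofLp) * Q n U

/-- The probability `⟨w| Q(U) ρ Q(U)† |w⟩ = Tr[ρ Q(U)† |w⟩⟨w| Q(U)]` of the outcome `w` given `U`. -/
def outcomeProb (b : OrthonormalBasis ι ℂ (Qubits n)) (ρ : Op n) (U : SU2) (w : ι) : ℝ :=
  (ρ * snapshot b U w).trace.re

/-- The expectation `𝔼_{U, w | ρ} f(U, w)`: the unitary `U` is drawn from `ν`, then `w` is the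
outcome of measuring `Q(U) ρ Q(U)†` in the basis `b`. -/
def expect {V : Type*} [NormedAddCommGroup V] [NormedSpace ℝ V] (ν : Measure SU2)
    (b : OrthonormalBasis ι ℂ (Qubits n)) (ρ : Op n) (f : SU2 → ι → V) : V :=
  ∑ w, ∫ U, outcomeProb b ρ U w • f U w ∂ν

lemma continuous_Q (x y : Bits n) : Continuous fun U : SU2 => Q n U x y := by
  unfold Q tensorPow
  simp only [Matrix.of_apply]
  refine continuous_finsetProd _ fun i _ => ?_
  exact (continuous_subtype_val (p := fun A => A ∈ Matrix.specialUnitaryGroup (Fin 2) ℂ)).matrix_elem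
    (x i) (y i)

lemma continuous_snapshot (b : OrthonormalBasis ι ℂ (Qubits n)) (w : ι) :
    Continuous fun U : SU2 => snapshot b U w := by
  have h : Continuous fun U : SU2 => Q n U := continuous_matrix fun x y => continuous_Q x y
  unfold snapshot
  exact (h.matrix_conjTranspose.matrix_mul continuous_const).matrix_mul h

/-- The measurement channel `𝓜(X) = 𝔼_{U ∼ ν} ∑_w Tr[X Q(U)† Π_w Q(U)] Q(U)† Π_w Q(U)`. -/
def channel (ν : Measure SU2) [IsFiniteMeasure ν] (b : OrthonormalBasis ι ℂ (Qubits n)) :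
    Op n →ₗ[ℂ] Op n where
  toFun X := Matrix.of fun x y =>
    ∫ U, (∑ w, (X * snapshot b U w).trace • snapshot b U w) x y ∂ν
  map_add' X Y := by
    ext x y
    simp only [Matrix.of_apply, Matrix.add_apply]
    rw [← integral_add]
    · refine integral_congr_ae (Filter.Eventually.of_forall fun U => ?_)
      simp [add_mul, add_smul, Matrix.sum_apply, Finset.sum_add_distrib]
    all_goals
      refine Continuous.integrable_of_hasCompactSupport ?_ (HasCompactSupport.of_compactSpace _)
      refine Continuous.matrix_elem (continuous_finsetSum _ fun w _ => ?_) x y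
      have h := continuous_snapshot b w
      exact (continuous_const.matrix_mul h).matrix_trace.smul h
  map_smul' c X := by
    ext x y
    simp only [Matrix.of_apply, Matrix.smul_apply, RingHom.id_apply, smul_eq_mul]
    rw [← integral_const_mul]
    refine integral_congr_ae (Filter.Eventually.of_forall fun U => ?_)
    simp [Matrix.sum_apply, Finset.mul_sum, mul_assoc]

/-- The visible space, the image of the measurement channel. -/
def visibleSpace (ν : Measure SU2) [IsFiniteMeasure ν] (b : OrthonormalBasis ι ℂ (Qubits n)) :
    Submodule ℂ (Op n) :=
  LinearMap.range (channel ν b)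

/-! #### The Moore–Penrose pseudoinverse -/

/-- The Hilbert–Schmidt inner product `⟨A, B⟩ = Tr[A† B]`. -/
def hs {d : Type*} [Fintype d] (A B : Matrix d d ℂ) : ℂ := (Aᴴ * B).trace

/-- `N` is the Moore–Penrose pseudoinverse of the map `M` on matrices, with respect to the
Hilbert–Schmidt inner product. -/
structure IsPseudoinverse {d : Type*} [Fintype d]
    (M N : Matrix d d ℂ →ₗ[ℂ] Matrix d d ℂ) : Prop where
  left : ∀ A, M (N (M A)) = M A
  right : ∀ A, N (M (N A)) = N A
  selfAdjoint_left : ∀ A B, hs (M (N A)) B = hs A (M (N B))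
  selfAdjoint_right : ∀ A B, hs (N (M A)) B = hs A (N (M B))

lemma exists_pseudoinverse_aux {E : Type*} [NormedAddCommGroup E] [InnerProductSpace ℂ E]
    [FiniteDimensional ℂ E] (M : E →ₗ[ℂ] E) : ∃ N : E →ₗ[ℂ] E,
      (∀ A, M (N (M A)) = M A) ∧ (∀ A, N (M (N A)) = N A) ∧
      (∀ A B, inner ℂ (M (N A)) B = inner ℂ A (M (N B))) ∧
      (∀ A B, inner ℂ (N (M A)) B = inner ℂ A (N (M B))) := by
  let K := LinearMap.ker M
  let R := LinearMap.range M
  let e : Kᗮ ≃ₗ[ℂ] R := M.kerComplementEquivRange (C := Kᗮ) (K.isCompl_orthogonal).symm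
  let N : E →ₗ[ℂ] E :=
    Kᗮ.subtype ∘ₗ e.symm.toLinearMap ∘ₗ R.orthogonalProjectionOnto.toLinearMap
  have he : ∀ x : Kᗮ, (e x : E) = M x := fun x => rfl
  have hMN : ∀ A, M (N A) = R.starProjection A := by
    intro A
    change M ((e.symm (R.orthogonalProjectionOnto A) : Kᗮ) : E) = _
    rw [← he, LinearEquiv.apply_symm_apply]
    rfl
  have hNM : ∀ A, N (M A) = Kᗮ.starProjection A := by
    intro A
    have h1 : M (Kᗮ.starProjection A) = M A := by
      have h2 : A - Kᗮ.starProjection A ∈ K := by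
        have h3 := Kᗮ.sub_starProjection_mem_orthogonal A
        rwa [Submodule.orthogonal_orthogonal] at h3
      have h4 : M (A - Kᗮ.starProjection A) = 0 := h2
      rw [map_sub, sub_eq_zero] at h4
      exact h4.symm
    have h5 : R.orthogonalProjectionOnto (M A) = e (Kᗮ.orthogonalProjectionOnto A) := by
      apply Subtype.ext
      rw [he]
      change R.starProjection (M A) = M (Kᗮ.starProjection A)
      rw [h1]
      exact Submodule.starProjection_eq_self_iff.mpr ⟨A, rfl⟩
    change ((e.symm (R.orthogonalProjectionOnto (M A)) : Kᗮ) : E) = _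
    rw [h5, LinearEquiv.symm_apply_apply]
    rfl
  refine ⟨N, ?_, ?_, ?_, ?_⟩
  · intro A
    rw [hMN]
    exact Submodule.starProjection_eq_self_iff.mpr ⟨A, rfl⟩
  · intro A
    rw [hNM]
    exact Submodule.starProjection_eq_self_iff.mpr (Submodule.coe_mem _)
  · intro A B
    rw [hMN, hMN, Submodule.inner_starProjection_left_eq_right]
  · intro A B
    rw [hNM, hNM, Submodule.inner_starProjection_left_eq_right]

/-- Every linear map on matrices has a pseudoinverse. -/
theorem exists_isPseudoinverse {d : Type*} [Fintype d]
    (M : Matrix d d ℂ →ₗ[ℂ] Matrix d d ℂ) : ∃ N, IsPseudoinverse M N := by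
  classical
  let i₁ : NormedAddCommGroup (Matrix d d ℂ) :=
    Matrix.toMatrixNormedAddCommGroup (1 : Matrix d d ℂ) Matrix.PosDef.one
  let i₂ : InnerProductSpace ℂ (Matrix d d ℂ) :=
    Matrix.toMatrixInnerProductSpace (1 : Matrix d d ℂ) Matrix.PosDef.one.posSemidef
  have hin : ∀ A B : Matrix d d ℂ, hs A B = inner ℂ A B := by
    intro A B
    change (Aᴴ * B).trace = (B * 1 * Aᴴ).trace
    rw [Matrix.mul_one, Matrix.trace_mul_comm]
  obtain ⟨N, h1, h2, h3, h4⟩ := exists_pseudoinverse_aux M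
  exact ⟨N, h1, h2, fun A B => by rw [hin, hin, h3], fun A B => by rw [hin, hin, h4]⟩

lemma hs_left_injective {d : Type*} [Fintype d] {A B : Matrix d d ℂ}
    (h : ∀ C, hs C A = hs C B) : A = B := by
  have h1 : ((A - B)ᴴ * (A - B)).trace = 0 := by
    have h2 := h (A - B)
    unfold hs at h2
    rw [Matrix.mul_sub, Matrix.trace_sub, h2, sub_self]
  exact sub_eq_zero.mp (Matrix.trace_conjTranspose_mul_self_eq_zero_iff.mp h1)

/-- The pseudoinverse is unique. -/
theorem IsPseudoinverse.unique {d : Type*} [Fintype d]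
    {M N N' : Matrix d d ℂ →ₗ[ℂ] Matrix d d ℂ} (h : IsPseudoinverse M N)
    (h' : IsPseudoinverse M N') : N = N' := by
  have h1 : ∀ B, N (M B) = N' (M B) := fun B => hs_left_injective fun A =>
    calc hs A (N (M B)) = hs (N (M A)) B := (h.selfAdjoint_right A B).symm
      _ = hs (N (M (N' (M A)))) B := by rw [h'.left]
      _ = hs A (N' (M (N (M B)))) := by rw [h.selfAdjoint_right, h'.selfAdjoint_right]
      _ = hs A (N' (M B)) := by rw [h.left]
  have h2 : ∀ B, M (N B) = M (N' B) := fun B => hs_left_injective fun A =>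
    calc hs A (M (N B)) = hs (M (N A)) B := (h.selfAdjoint_left A B).symm
      _ = hs (M (N' (M (N A)))) B := by rw [h'.left]
      _ = hs A (M (N (M (N' B)))) := by rw [h'.selfAdjoint_left, h.selfAdjoint_left]
      _ = hs A (M (N' B)) := by rw [h.left]
  ext1 A
  rw [← h.right A, h1, h2, h'.right]

/-- The Moore–Penrose pseudoinverse. -/
def pinv {d : Type*} [Fintype d] (M : Matrix d d ℂ →ₗ[ℂ] Matrix d d ℂ) :
    Matrix d d ℂ →ₗ[ℂ] Matrix d d ℂ :=
  (exists_isPseudoinverse M).choose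

theorem pinv_spec {d : Type*} [Fintype d] (M : Matrix d d ℂ →ₗ[ℂ] Matrix d d ℂ) :
    IsPseudoinverse M (pinv M) :=
  (exists_isPseudoinverse M).choose_spec

/-! #### Estimators -/

/-- The single-shot estimator `ô(U, w) = Tr[𝓜⁻¹(Q(U)† Π_w Q(U)) O]` of `Tr[ρ O]`. -/
def estimator (ν : Measure SU2) [IsFiniteMeasure ν] (b : OrthonormalBasis ι ℂ (Qubits n))
    (O : Op n) (U : SU2) (w : ι) : ℂ :=
  (pinv (channel ν b) (snapshot b U w) * O).trace

/-- The variance `𝔼 |ô - 𝔼 ô|²` of the single-shot estimator in the state `ρ`.  (The estimator is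
real-valued if `O` is Hermitian.) -/
def estimatorVariance (ν : Measure SU2) [IsFiniteMeasure ν]
    (b : OrthonormalBasis ι ℂ (Qubits n)) (ρ O : Op n) : ℝ :=
  expect ν b ρ fun U w => ‖estimator ν b O U w - expect ν b ρ (estimator ν b O)‖ ^ 2

end Protocol

end

end SU2Shadows

namespace SU2Shadows

noncomputable section

open MeasureTheory Matrix
open scoped ComplexOrder

/-! ### Tensor products of families of matrices -/

section Tens

variable {d : Type*} {m : ℕ}

/-! The argument works one copy of an irreducible representation at a time. Let `V` be the isometry
(`frame`) onto the span of the vectors `|λ, q, t⟩` with `λ`, `t` fixed, let `d` be its dimension and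
`D(U)` the action of `U` on it. An operator `V Y V†` is seen only by outcomes of its own block,
through the diagonal entries of `D(U) Y D(U)†`. Hence the Haar channel sends `V Y V†` to `V M(Y) V†`
(`IsSpinBlock.channel_frame_conj`), where `M` is self-adjoint, commutes with conjugation by `D(U)`,
and has quadratic form the Haar average of the squared norm of the diagonal of `D(U) Y D(U)†`.

The main point is that every eigenvalue `μ` of `M` is at least `1 / (2 d - 1)`
(`hs_le_of_equivariant`), and no Clebsch–Gordan decomposition is needed for it. The eigenspace `W`
of `μ` is invariant under `SU(2)`, and its weight-zero part `W₀` consists of its diagonal matrices.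
Taking the trace of the quadratic form over `W` gives `dim W₀ ≤ μ dim W` (`finrank_le_of_average`).
The adjoint action has the `2 d - 1` weights `-(d - 1), …, d - 1`, and raising or lowering to weight
zero is injective on each weight space, so `dim W ≤ (2 d - 1) dim W₀`
(`finrank_le_mul_finrank_weightSpace_zero`).

A permutation-invariant `O` commutes with every projection `V V†`, by the half of Schur–Weyl duality
in `commute_of_commute_Q`, so it is the sum of its compressions to the blocks. Inverting `M` on each
block gives `Y` with `𝓜(Y) = O`, and self-adjointness of `𝓜` turns the estimator into `Tr[Y Q(U)†
Π_w Q(U)]` (`estimator_eq`). Unbiasedness is then immediate. This value is a diagonal entry of a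
unitary conjugate of `M⁻¹(V† O V)`, so its square is at most `(2 d - 1)² ‖V† O V‖²_HS ≤ (2 d - 1)² d
‖O‖²` with `d ≤ n + 1`. The estimator is thus bounded outcome by outcome, which bounds its variance.
A design enters through its channel, which depends only on second moments
(`IsThreeDesign.channel_eq`). -/

/-- The tensor product `A₁ ⊗ ⋯ ⊗ A_m` of a family of matrices. -/
def tens (A : Fin m → Matrix d d ℂ) : Matrix (Fin m → d) (Fin m → d) ℂ :=
  Matrix.of fun x y => ∏ i, A i (x i) (y i)

lemma tens_apply (A : Fin m → Matrix d d ℂ) (x y : Fin m → d) :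
    tens A x y = ∏ i, A i (x i) (y i) := rfl

lemma tensorPow_eq_tens (A : Matrix d d ℂ) : tensorPow m A = tens fun _ => A := rfl

lemma tens_mul [Fintype d] (A B : Fin m → Matrix d d ℂ) :
    tens A * tens B = tens (A * B) := by
  classical
  ext x y
  simp only [Matrix.mul_apply, tens_apply, Pi.mul_apply, ← Finset.prod_mul_distrib]
  rw [Finset.prod_univ_sum, Fintype.piFinset_univ]

lemma tens_one [DecidableEq d] : tens (1 : Fin m → Matrix d d ℂ) = 1 := by
  ext x y
  simp only [tens_apply, Pi.one_apply, Matrix.one_apply]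
  rw [Finset.prod_ite_zero]
  simp [funext_iff]

lemma tens_conjTranspose (A : Fin m → Matrix d d ℂ) :
    (tens A)ᴴ = tens fun i => (A i)ᴴ := by
  ext x y
  simp [tens_apply, Matrix.conjTranspose_apply]

/-- The sum `∑ᵢ Aᵢ` of the copies of the one-particle operator `A`. -/
def collective [DecidableEq d] (m : ℕ) (A : Matrix d d ℂ) : Matrix (Fin m → d) (Fin m → d) ℂ :=
  ∑ i, tens (Function.update 1 i A)

lemma tens_update_apply [DecidableEq d] (i : Fin m) (A : Matrix d d ℂ) (x y : Fin m → d) :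
    tens (Function.update 1 i A) x y =
      (∏ j ∈ Finset.univ.erase i, (1 : Matrix d d ℂ) (x j) (y j)) * A (x i) (y i) := by
  rw [tens_apply, ← Finset.prod_erase_mul _ _ (Finset.mem_univ i)]
  congr 1
  · refine Finset.prod_congr rfl fun j hj => ?_
    rw [Function.update_of_ne (Finset.ne_of_mem_erase hj)]
    rfl
  · rw [Function.update_self]

lemma collective_apply [DecidableEq d] (A : Matrix d d ℂ) (x y : Fin m → d) :
    collective m A x y =
      ∑ i, (∏ j ∈ Finset.univ.erase i, (1 : Matrix d d ℂ) (x j) (y j)) * A (x i) (y i) := by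
  simp only [collective, Matrix.sum_apply, tens_update_apply]

lemma collective_add [DecidableEq d] (A B : Matrix d d ℂ) :
    collective m (A + B) = collective m A + collective m B := by
  ext x y
  simp [collective_apply, mul_add, Finset.sum_add_distrib]

lemma collective_smul [DecidableEq d] (c : ℂ) (A : Matrix d d ℂ) :
    collective m (c • A) = c • collective m A := by
  ext x y
  simp [collective_apply, Finset.mul_sum, mul_left_comm]

lemma collective_sub [DecidableEq d] (A B : Matrix d d ℂ) :
    collective m (A - B) = collective m A - collective m B := by
  ext x y
  simp [collective_apply, mul_sub, Finset.sum_sub_distrib]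

lemma collective_conjTranspose [DecidableEq d] (A : Matrix d d ℂ) :
    (collective m A)ᴴ = collective m Aᴴ := by
  rw [collective, Matrix.conjTranspose_sum, collective]
  refine Finset.sum_congr rfl fun i _ => ?_
  rw [tens_conjTranspose]
  congr 1
  ext1 j
  by_cases h : j = i
  · subst h; simp
  · simp [Function.update_of_ne h]

/-- Operators on different tensor factors commute, so only the terms with both factors at the same
site survive. -/
lemma collective_commutator [DecidableEq d] [Fintype d] (A B : Matrix d d ℂ) :
    collective m A * collective m B - collective m B * collective m A =
      collective m (A * B - B * A) := by
  rw [collective_sub]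
  simp only [collective, Finset.sum_mul_sum, tens_mul]
  rw [Finset.sum_comm (f := fun i j : Fin m => tens
    (Function.update (1 : Fin m → Matrix d d ℂ) i B * Function.update (1 : Fin m → _) j A))]
  rw [← Finset.sum_sub_distrib, ← Finset.sum_sub_distrib]
  refine Finset.sum_congr rfl fun i _ => ?_
  rw [← Finset.sum_sub_distrib, Finset.sum_eq_single i]
  · rw [← Function.update_mul, ← Function.update_mul, one_mul]
  · intro j _ hj
    have : Function.update (1 : Fin m → Matrix d d ℂ) i A * Function.update (1 : Fin m → _) j B =
        Function.update (1 : Fin m → _) j B * Function.update (1 : Fin m → _) i A := by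
      ext1 l
      by_cases h : l = i
      · subst h
        simp [Function.update_of_ne hj.symm]
      · simp [Function.update_of_ne h]
    rw [this, sub_self]
  · simp

/-- This is the product rule: at `θ = 0` all the undifferentiated factors are the identity. -/
lemma hasDerivAt_tensorPow [DecidableEq d] {γ : ℝ → Matrix d d ℂ} {A : Matrix d d ℂ}
    (h0 : γ 0 = 1) (hγ : ∀ a b, HasDerivAt (fun θ => γ θ a b) (A a b) 0) (x y : Fin m → d) :
    HasDerivAt (fun θ => tensorPow m (γ θ) x y) (collective m A x y) 0 := by
  have h := HasDerivAt.fun_finsetProd (u := Finset.univ) (x := (0 : ℝ))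
    (f := fun (i : Fin m) θ => γ θ (x i) (y i)) (f' := fun i => A (x i) (y i))
    fun i _ => hγ _ _
  rw [collective_apply]
  simp only [h0, smul_eq_mul] at h
  exact h

end Tens

/-! ### The tensor representation of `SU(2)` -/

section Rep

variable {n : ℕ}

lemma Q_mul (U V : SU2) : Q n (U * V) = Q n U * Q n V := by
  simp only [Q, tensorPow_eq_tens, tens_mul]
  rfl

lemma Q_one : Q n 1 = 1 := by
  exact tens_one (m := n) (d := Fin 2)

lemma Q_conjTranspose (U : SU2) : (Q n U)ᴴ = Q n U⁻¹ := by
  simp only [Q, tensorPow_eq_tens, tens_conjTranspose]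
  rfl

lemma Q_conjTranspose_mul_self (U : SU2) : (Q n U)ᴴ * Q n U = 1 := by
  rw [Q_conjTranspose, ← Q_mul, inv_mul_cancel, Q_one]

lemma Q_mul_conjTranspose_self (U : SU2) : Q n U * (Q n U)ᴴ = 1 := by
  rw [Q_conjTranspose, ← Q_mul, mul_inv_cancel, Q_one]

/-! ### Generators of the Lie algebra, as derivatives of curves in `SU(2)` -/

/-- The one-particle raising operator. -/
def σPlus : Matrix (Fin 2) (Fin 2) ℂ := !![0, 1; 0, 0]

/-- The real rotation by the angle `θ`, as an element of `SU(2)`. -/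
def rotY (θ : ℝ) : SU2 :=
  ⟨!![(Real.cos θ : ℂ), -(Real.sin θ : ℂ); (Real.sin θ : ℂ), (Real.cos θ : ℂ)], by
    have h : (Real.cos θ : ℂ) * Real.cos θ + Real.sin θ * Real.sin θ = 1 := by
      rw [← sq, ← sq]; exact_mod_cast Real.cos_sq_add_sin_sq θ
    rw [Matrix.mem_specialUnitaryGroup_iff, Matrix.mem_unitaryGroup_iff]
    constructor
    · ext i j
      fin_cases i <;> fin_cases j <;>
        simp [Matrix.mul_apply, Fin.sum_univ_two, -Complex.ofReal_cos, -Complex.ofReal_sin] <;>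
        first | linear_combination h | ring
    · rw [Matrix.det_fin_two_of]; linear_combination h⟩

/-- The rotation `exp (i θ σₓ)` in `SU(2)`. -/
def rotX (θ : ℝ) : SU2 :=
  ⟨!![(Real.cos θ : ℂ), Complex.I * (Real.sin θ : ℂ);
      Complex.I * (Real.sin θ : ℂ), (Real.cos θ : ℂ)], by
    have h : (Real.cos θ : ℂ) * Real.cos θ + Real.sin θ * Real.sin θ = 1 := by
      rw [← sq, ← sq]; exact_mod_cast Real.cos_sq_add_sin_sq θ
    rw [Matrix.mem_specialUnitaryGroup_iff, Matrix.mem_unitaryGroup_iff]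
    constructor
    · ext i j
      fin_cases i <;> fin_cases j <;>
        simp [Matrix.mul_apply, Fin.sum_univ_two, -Complex.ofReal_cos, -Complex.ofReal_sin] <;>
        first | linear_combination h - (Real.sin θ : ℂ) ^ 2 * Complex.I_mul_I | ring
    · rw [Matrix.det_fin_two_of]
      linear_combination h - (Real.sin θ : ℂ) ^ 2 * Complex.I_mul_I⟩

lemma rotY_zero : rotY 0 = 1 := by
  apply Subtype.ext
  ext i j
  fin_cases i <;> fin_cases j <;> simp [rotY]

lemma rotX_zero : rotX 0 = 1 := by
  apply Subtype.ext
  ext i j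
  fin_cases i <;> fin_cases j <;> simp [rotX]

lemma hasDerivAt_rotY (a c : Fin 2) :
    HasDerivAt (fun θ => (rotY θ).1 a c) ((!![0, -1; 1, 0] : Matrix (Fin 2) (Fin 2) ℂ) a c) 0 := by
  have hs : HasDerivAt (fun θ : ℝ => (Real.sin θ : ℂ)) 1 0 := by
    simpa using (Real.hasDerivAt_sin 0).ofReal_comp
  have hc : HasDerivAt (fun θ : ℝ => (Real.cos θ : ℂ)) 0 0 := by
    simpa using (Real.hasDerivAt_cos 0).ofReal_comp
  fin_cases a <;> fin_cases c
  · exact hc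
  · exact hs.neg
  · exact hs
  · exact hc

lemma hasDerivAt_rotX (a c : Fin 2) :
    HasDerivAt (fun θ => (rotX θ).1 a c)
      ((!![0, Complex.I; Complex.I, 0] : Matrix (Fin 2) (Fin 2) ℂ) a c) 0 := by
  have hs : HasDerivAt (fun θ : ℝ => Complex.I * (Real.sin θ : ℂ)) Complex.I 0 := by
    simpa using (Real.hasDerivAt_sin 0).ofReal_comp.const_mul Complex.I
  have hc : HasDerivAt (fun θ : ℝ => (Real.cos θ : ℂ)) 0 0 := by
    simpa using (Real.hasDerivAt_cos 0).ofReal_comp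
  fin_cases a <;> fin_cases c
  · exact hc
  · exact hs
  · exact hs
  · exact hc

/-- The raising operator `J₊` on `n` qubits. -/
def Jp (n : ℕ) : Op n := collective n σPlus

/-- The raising operator lies only in the complexified Lie algebra. Writing it through the
velocities of `rotY` and `rotX` lets statements about the group be differentiated and then extended
linearly. -/
lemma Jp_eq : Jp n = -(1 / 2 : ℂ) • (collective n !![0, -1; 1, 0] +
    Complex.I • collective n !![0, Complex.I; Complex.I, 0]) := by
  rw [← collective_smul, ← collective_add, ← collective_smul, Jp]
  congr 1
  ext i j
  fin_cases i <;> fin_cases j <;> simp [σPlus]; norm_num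

lemma Jp_conjTranspose_eq : (Jp n)ᴴ = (1 / 2 : ℂ) • (collective n !![0, -1; 1, 0] -
    Complex.I • collective n !![0, Complex.I; Complex.I, 0]) := by
  rw [← collective_smul, ← collective_sub, ← collective_smul, Jp, collective_conjTranspose]
  congr 1
  ext i j
  fin_cases i <;> fin_cases j <;> simp [σPlus]; norm_num

lemma Jz_eq : Jz n = collective n !![1 / 2, 0; 0, -(1 / 2)] := by
  ext x y
  rw [Jz, collective_apply, Matrix.diagonal_apply]
  split_ifs with h
  · subst h
    refine Finset.sum_congr rfl fun i _ => ?_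
    simp only [Matrix.one_apply_eq, Finset.prod_const_one, one_mul]
    generalize x i = a
    fin_cases a <;> simp
  · symm
    refine Finset.sum_eq_zero fun i _ => ?_
    by_cases hi : x i = y i
    · obtain ⟨j, hj⟩ := Function.ne_iff.mp h
      have hji : j ≠ i := fun e => hj (e ▸ hi)
      refine mul_eq_zero_of_left (Finset.prod_eq_zero
        (Finset.mem_erase.mpr ⟨hji, Finset.mem_univ j⟩) ?_) _
      exact Matrix.one_apply_ne hj
    · have : (!![1 / 2, 0; 0, -(1 / 2)] : Matrix (Fin 2) (Fin 2) ℂ) (x i) (y i) = 0 := by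
        generalize x i = a at hi ⊢
        generalize y i = c at hi ⊢
        fin_cases a <;> fin_cases c <;> simp_all
      rw [this, mul_zero]

lemma Jp_commutator : Jp n * (Jp n)ᴴ - (Jp n)ᴴ * Jp n = (2 : ℂ) • Jz n := by
  rw [Jp, collective_conjTranspose, collective_commutator, Jz_eq, ← collective_smul]
  congr 1
  ext i j
  fin_cases i <;> fin_cases j <;>
    simp [σPlus, Matrix.mul_apply, Fin.sum_univ_two, Matrix.sub_apply, -Matrix.cons_mul]

lemma Jz_commutator : Jz n * Jp n - Jp n * Jz n = Jp n := by
  rw [Jp, Jz_eq, collective_commutator]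
  congr 1
  ext i j
  fin_cases i <;> fin_cases j <;> simp [σPlus]; norm_num

end Rep

/-! ### Schur–Weyl duality: the tensor powers of `SU(2)` generate the symmetric operators -/

section SchurWeyl

variable {n : ℕ}

/-- Two families with the same number of occurrences of each value differ by a permutation. -/
lemma exists_perm_of_sum_single_eq {ι α : Type*} [Fintype ι] {g g' : ι → α}
    (h : ∑ i, Finsupp.single (g i) 1 = ∑ i, Finsupp.single (g' i) (1 : ℕ)) :
    ∃ π : Equiv.Perm ι, g' ∘ π = g := by
  classical
  have hc : ∀ (g : ι → α) (a : α),
      Fintype.card {i // g i = a} = (∑ i, Finsupp.single (g i) (1 : ℕ)) a := by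
    intro g a
    simp only [Finsupp.finsetSum_apply, Finsupp.single_apply]
    rw [Fintype.card_subtype, Finset.card_filter]
  let e : ∀ a, {i // g i = a} ≃ {i // g' i = a} := fun a =>
    Fintype.equivOfCardEq (by rw [hc, hc, h])
  refine ⟨(Equiv.sigmaFiberEquiv g).symm.trans
    ((Equiv.sigmaCongrRight e).trans (Equiv.sigmaFiberEquiv g')), ?_⟩
  ext1 i
  exact (e (g i) ⟨i, rfl⟩).2

lemma IsPermInvariant.apply_comp {O : Op n} (hO : IsPermInvariant O) (π : Equiv.Perm (Fin n))
    (x y : Bits n) : O (x ∘ π) (y ∘ π) = O x y := by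
  have h := congrFun (congrFun (hO π).eq x) (y ∘ π)
  have h1 : (permOp n π * O) x (y ∘ π) = O (x ∘ π) (y ∘ π) := by
    rw [Matrix.mul_apply, Finset.sum_eq_single (x ∘ π)]
    · simp [permOp, Function.comp_assoc]
    · intro z _ hz
      have : x ≠ z ∘ π.symm := by
        rintro rfl
        exact hz (by simp [Function.comp_assoc])
      simp [permOp, this]
    · simp
  have h2 : (O * permOp n π) x (y ∘ π) = O x y := by
    rw [Matrix.mul_apply, Finset.sum_eq_single y]
    · simp [permOp, Function.comp_assoc]
    · intro z _ hz
      have : z ≠ (y ∘ π) ∘ π.symm := by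
        simpa [Function.comp_assoc] using hz
      simp [permOp, this]
    · simp
  rw [← h1, h, h2]

/-- The number of occurrences of each pair in the pair of strings `(x, y)`. -/
def pairType (x y : Bits n) : (Fin 2 × Fin 2) →₀ ℕ := ∑ i, Finsupp.single (x i, y i) 1

/-- An invariant matrix is constant on the orbits of pairs of strings under simultaneous
permutation, and an orbit is determined by how often each pair of letters occurs. -/
lemma IsPermInvariant.exists_eq_pairType {O : Op n} (hO : IsPermInvariant O) :
    ∃ f : ((Fin 2 × Fin 2) →₀ ℕ) → ℂ, ∀ x y, O x y = f (pairType x y) := by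
  classical
  -- The value `0` at exponents that are not the type of a pair of strings of length `n` is
  -- arbitrary.
  refine ⟨fun α => if h : ∃ xy : Bits n × Bits n, pairType xy.1 xy.2 = α then
    O h.choose.1 h.choose.2 else 0, fun x y => ?_⟩
  have hex : ∃ xy : Bits n × Bits n, pairType xy.1 xy.2 = pairType x y := ⟨(x, y), rfl⟩
  refine Eq.trans ?_ (dif_pos hex).symm
  obtain ⟨π, hπ⟩ := exists_perm_of_sum_single_eq hex.choose_spec.symm
  rw [← hO.apply_comp π hex.choose.1]
  congr 1
  · ext1 i; exact (congrArg Prod.fst (congrFun hπ i)).symm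
  · ext1 i; exact (congrArg Prod.snd (congrFun hπ i)).symm

/-- The generic quaternion with complexified coordinates, as a `2 × 2` matrix. -/
def quat (c : Fin 4 → ℂ) : Matrix (Fin 2) (Fin 2) ℂ :=
  !![c 0 + Complex.I * c 1, -c 2 + Complex.I * c 3; c 2 + Complex.I * c 3, c 0 - Complex.I * c 1]

lemma quat_surjective : Function.Surjective quat := by
  intro A
  refine ⟨![(A 0 0 + A 1 1) / 2, -Complex.I * (A 0 0 - A 1 1) / 2, (A 1 0 - A 0 1) / 2,
    -Complex.I * (A 1 0 + A 0 1) / 2], ?_⟩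
  ext i j
  fin_cases i <;> fin_cases j <;> simp [quat]
  · linear_combination (-(A 0 0 - A 1 1) / 2) * Complex.I_mul_I
  · linear_combination (-(A 1 0 + A 0 1) / 2) * Complex.I_mul_I
  · linear_combination (-(A 1 0 + A 0 1) / 2) * Complex.I_mul_I
  · linear_combination ((A 0 0 - A 1 1) / 2) * Complex.I_mul_I

/-- Real quaternions are the real multiples of `SU(2)`, so conditions homogeneous in the matrix pass
from the group to a real form of all `2 × 2` matrices. -/
lemma exists_quat_eq_smul (r : Fin 4 → ℝ) :
    ∃ (s : ℂ) (U : SU2), quat (fun i => (r i : ℂ)) = s • U.1 := by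
  by_cases hr : ∀ i, r i = 0
  · refine ⟨0, 1, ?_⟩
    ext i j
    fin_cases i <;> fin_cases j <;> simp [quat, hr]
  set N : ℝ := r 0 ^ 2 + r 1 ^ 2 + r 2 ^ 2 + r 3 ^ 2 with hN
  have hNpos : 0 < N := by
    push Not at hr
    obtain ⟨i, hi⟩ := hr
    have := pow_pos (abs_pos.mpr hi) 2
    rw [sq_abs] at this
    fin_cases i <;> simp only [hN] <;> simp at this <;> positivity
  have hs : ((√N : ℝ) : ℂ) ≠ 0 := by exact_mod_cast (Real.sqrt_pos.mpr hNpos).ne'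
  have hss : ((√N : ℝ) : ℂ) * (√N : ℝ) = r 0 ^ 2 + r 1 ^ 2 + r 2 ^ 2 + r 3 ^ 2 := by
    rw [← Complex.ofReal_mul, Real.mul_self_sqrt hNpos.le, hN]
    push_cast
    ring
  have hI := Complex.I_mul_I
  have hinv : ((√N : ℝ) : ℂ)⁻¹ * ((√N : ℝ) : ℂ)⁻¹ *
      ((r 0 : ℂ) ^ 2 + r 1 ^ 2 + r 2 ^ 2 + r 3 ^ 2) = 1 := by
    rw [← hss]
    field_simp
  refine ⟨(√N : ℝ), ⟨((√N : ℝ) : ℂ)⁻¹ • quat fun i => (r i : ℂ), ?_⟩, ?_⟩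
  · rw [Matrix.mem_specialUnitaryGroup_iff, Matrix.mem_unitaryGroup_iff]
    constructor
    · ext i j
      fin_cases i <;> fin_cases j <;>
        simp [quat, Matrix.mul_apply, Fin.sum_univ_two]
      · linear_combination hinv - ((√N : ℝ) : ℂ)⁻¹ * ((√N : ℝ) : ℂ)⁻¹ *
          ((r 1 : ℂ) ^ 2 + (r 3 : ℂ) ^ 2) * hI
      · ring
      · ring
      · linear_combination hinv - ((√N : ℝ) : ℂ)⁻¹ * ((√N : ℝ) : ℂ)⁻¹ *
          ((r 1 : ℂ) ^ 2 + (r 3 : ℂ) ^ 2) * hI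
    · rw [Matrix.det_smul, quat, Matrix.det_fin_two_of, Fintype.card_fin]
      linear_combination hinv - ((√N : ℝ) : ℂ)⁻¹ * ((√N : ℝ) : ℂ)⁻¹ *
          ((r 1 : ℂ) ^ 2 + (r 3 : ℂ) ^ 2) * hI
  · change _ = _ • (_ • _)
    rw [smul_smul, mul_inv_cancel₀ hs, one_smul]

lemma tensorPow_smul {d : Type*} {m : ℕ} (s : ℂ) (A : Matrix d d ℂ) :
    tensorPow m (s • A) = s ^ m • tensorPow m A := by
  ext x y
  simp [tensorPow, Finset.prod_mul_distrib]

/-- The matrix entry `(x, y)` of `P A^{⊗ n} - A^{⊗ n} P`, as a polynomial in the entries of `A`. -/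
def commutatorPoly (P : Op n) (x y : Bits n) : MvPolynomial (Fin 2 × Fin 2) ℂ :=
  ∑ z, MvPolynomial.monomial (pairType z y) (P x z) -
    ∑ z, MvPolynomial.monomial (pairType x z) (P z y)

lemma eval_commutatorPoly (P : Op n) (x y : Bits n) (A : Matrix (Fin 2) (Fin 2) ℂ) :
    MvPolynomial.eval (fun ab => A ab.1 ab.2) (commutatorPoly P x y) =
      (P * tensorPow n A - tensorPow n A * P) x y := by
  have h : ∀ (x y : Bits n) (c : ℂ), MvPolynomial.eval (fun ab : Fin 2 × Fin 2 => A ab.1 ab.2)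
      (MvPolynomial.monomial (pairType x y) c) = c * tensorPow n A x y := by
    intro x y c
    rw [MvPolynomial.eval_monomial, pairType, tensorPow, Matrix.of_apply,
      ← Finsupp.prod_finsetSum_index (by simp) (by intros; rw [pow_add])]
    simp
  simp only [commutatorPoly, map_sub, map_sum, h, Matrix.sub_apply, Matrix.mul_apply]
  simp only [mul_comm]

/-- `SU(2)` together with scalars is Zariski dense in the `2 × 2` matrices: the polynomial vanishes
at real quaternions, hence at complexified ones, and these are all matrices. -/
lemma commutatorPoly_eq_zero {P : Op n} (hP : ∀ U : SU2, Commute P (Q n U)) (x y : Bits n) :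
    commutatorPoly P x y = 0 := by
  let q : Fin 2 × Fin 2 → MvPolynomial (Fin 4) ℂ := fun ab =>
    (!![MvPolynomial.X 0 + MvPolynomial.C Complex.I * MvPolynomial.X 1,
        -MvPolynomial.X 2 + MvPolynomial.C Complex.I * MvPolynomial.X 3;
        MvPolynomial.X 2 + MvPolynomial.C Complex.I * MvPolynomial.X 3,
        MvPolynomial.X 0 - MvPolynomial.C Complex.I * MvPolynomial.X 1] :
      Matrix (Fin 2) (Fin 2) (MvPolynomial (Fin 4) ℂ)) ab.1 ab.2
  have hq : ∀ (c : Fin 4 → ℂ) p,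
      MvPolynomial.eval c (MvPolynomial.bind₁ q p) =
        MvPolynomial.eval (fun ab => quat c ab.1 ab.2) p := by
    intro c p
    rw [MvPolynomial.eval, MvPolynomial.eval₂Hom_bind₁]
    congr 2
    ext1 ⟨a, b⟩
    fin_cases a <;> fin_cases b <;> simp [q, quat]
  have h0 : MvPolynomial.bind₁ q (commutatorPoly P x y) = 0 := by
    -- A polynomial vanishing on a product of infinite sets is zero; here each set is the real line
    -- inside `ℂ`.
    refine MvPolynomial.funext_set (fun _ => Set.range ((↑) : ℝ → ℂ))
      (fun _ => Set.infinite_range_of_injective Complex.ofReal_injective) fun c hc => ?_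
    choose r hr using fun i => hc i (Set.mem_univ i)
    obtain rfl : (fun i => (r i : ℂ)) = c := funext hr
    obtain ⟨s, U, hU⟩ := exists_quat_eq_smul r
    have hcomm : P * tensorPow n U.1 = tensorPow n U.1 * P := (hP U).eq
    rw [hq, eval_commutatorPoly, hU, tensorPow_smul, Matrix.mul_smul, Matrix.smul_mul, hcomm,
      sub_self, map_zero, Matrix.zero_apply]
  refine MvPolynomial.funext fun a => ?_
  obtain ⟨c, hc⟩ := quat_surjective (Matrix.of fun i j => a (i, j))
  have ha : a = fun ab => quat c ab.1 ab.2 := by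
    rw [hc]; rfl
  rw [ha, ← hq, h0, map_zero, map_zero]

/-- An operator commuting with `U^{⊗ n}` for all `U ∈ SU(2)` commutes with all
permutation-invariant operators. -/
theorem commute_of_commute_Q {P O : Op n} (hP : ∀ U : SU2, Commute P (Q n U))
    (hO : IsPermInvariant O) : Commute P O := by
  obtain ⟨f, hf⟩ := hO.exists_eq_pairType
  -- `L` replaces each monomial `α` by `f α`. It carries the generic tensor power to `O`, and hence
  -- the vanishing polynomials to the entries of `P O - O P`.
  let L := (MvPolynomial.basisMonomials (Fin 2 × Fin 2) ℂ).constr ℂ f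
  have hL : ∀ α c, L (MvPolynomial.monomial α c) = c * f α := by
    intro α c
    have : MvPolynomial.monomial α c =
        c • MvPolynomial.basisMonomials (Fin 2 × Fin 2) ℂ α := by
      simp [MvPolynomial.coe_basisMonomials, MvPolynomial.smul_monomial]
    rw [this, map_smul, Module.Basis.constr_basis, smul_eq_mul]
  ext x y
  have h := congrArg L (commutatorPoly_eq_zero hP x y)
  rw [commutatorPoly, map_sub, map_sum, map_sum, map_zero, sub_eq_zero] at h
  simp only [hL, ← hf] at h
  rw [Matrix.mul_apply, h, Matrix.mul_apply]
  simp only [mul_comm]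

end SchurWeyl

/-! ### The measurement channel -/

section Channel

variable {n : ℕ} {ι : Type*} [Fintype ι]

instance : IsProbabilityMeasure haarSU2 := by
  refine ⟨?_⟩
  have h := Measure.haarMeasure_self (K₀ := (⊤ : TopologicalSpace.PositiveCompacts SU2))
  rwa [TopologicalSpace.PositiveCompacts.coe_top] at h

instance : haarSU2.IsHaarMeasure := Measure.isHaarMeasure_haarMeasure _

/-- A right translate of the Haar measure is again a left-invariant probability measure, so
uniqueness applies. -/
lemma map_mul_right_haarSU2 (V : SU2) : haarSU2.map (· * V) = haarSU2 := by
  have hm : Measurable fun U : SU2 => U * V := (continuous_mul_const V).measurable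
  have : IsProbabilityMeasure (haarSU2.map (· * V)) :=
    Measure.isProbabilityMeasure_map hm.aemeasurable
  have : (haarSU2.map (· * V)).IsHaarMeasure :=
    Measure.isHaarMeasure_map_mul_right haarSU2 V
  exact Measure.isHaarMeasure_eq_of_isProbabilityMeasure _ _

lemma integral_mul_right_haarSU2 {f : SU2 → ℂ} (hf : Continuous f) (V : SU2) :
    ∫ U, f (U * V) ∂haarSU2 = ∫ U, f U ∂haarSU2 := by
  have hm : Measurable fun U : SU2 => U * V := (continuous_mul_const V).measurable
  conv_rhs => rw [← map_mul_right_haarSU2 V]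
  rw [integral_map hm.aemeasurable hf.aestronglyMeasurable]

lemma integrable_of_continuous {E : Type*} [NormedAddCommGroup E] (ν : Measure SU2)
    [IsFiniteMeasure ν] {f : SU2 → E} (hf : Continuous f) : Integrable f ν :=
  hf.integrable_of_hasCompactSupport (HasCompactSupport.of_compactSpace _)

lemma hs_conj {d : Type*} [Fintype d] (A B : Matrix d d ℂ) : star (hs A B) = hs B A := by
  rw [hs, ← Matrix.trace_conjTranspose, Matrix.conjTranspose_mul, Matrix.conjTranspose_conjTranspose,
    hs]

lemma snapshot_conjTranspose (b : OrthonormalBasis ι ℂ (Qubits n)) (U : SU2) (w : ι) :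
    (snapshot b U w)ᴴ = snapshot b U w := by
  simp [snapshot, Matrix.conjTranspose_mul, Matrix.mul_assoc, Matrix.conjTranspose_vecMulVec]

lemma snapshot_mul (b : OrthonormalBasis ι ℂ (Qubits n)) (U V : SU2) (w : ι) :
    snapshot b (U * V) w = (Q n V)ᴴ * snapshot b U w * Q n V := by
  simp [snapshot, Q_mul, Matrix.conjTranspose_mul, Matrix.mul_assoc]

lemma continuous_trace_mul_snapshot (b : OrthonormalBasis ι ℂ (Qubits n)) (w : ι) (X : Op n) :
    Continuous fun U => (X * snapshot b U w).trace :=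
  (continuous_const.matrix_mul (continuous_snapshot b w)).matrix_trace

lemma star_trace_mul_snapshot (b : OrthonormalBasis ι ℂ (Qubits n)) (U : SU2) (w : ι) (X : Op n) :
    star (X * snapshot b U w).trace = (Xᴴ * snapshot b U w).trace := by
  rw [← Matrix.trace_conjTranspose, Matrix.conjTranspose_mul, snapshot_conjTranspose,
    Matrix.trace_mul_comm]

/-- The sesquilinear form of the measurement channel. -/
theorem hs_channel (ν : Measure SU2) [IsFiniteMeasure ν] (b : OrthonormalBasis ι ℂ (Qubits n))
    (Z X : Op n) :
    hs Z (channel ν b X) =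
      ∫ U, ∑ w, (Zᴴ * snapshot b U w).trace * (X * snapshot b U w).trace ∂ν := by
  have hc : ∀ x y, Continuous fun U =>
      (∑ w, (X * snapshot b U w).trace • snapshot b U w) x y := fun x y =>
    Continuous.matrix_elem (continuous_finsetSum _ fun w _ =>
      (continuous_trace_mul_snapshot b w X).smul (continuous_snapshot b w)) x y
  have h1 : hs Z (channel ν b X) = ∑ i, ∑ j, Zᴴ i j *
      ∫ U, (∑ w, (X * snapshot b U w).trace • snapshot b U w) j i ∂ν := rfl
  have h3 : hs Z (channel ν b X) = ∫ U, ∑ i, ∑ j, Zᴴ i j *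
      (∑ w, (X * snapshot b U w).trace • snapshot b U w) j i ∂ν := by
    have hg : ∀ i j, Continuous fun U : SU2 => Zᴴ i j *
        (∑ w, (X * snapshot b U w).trace • snapshot b U w) j i :=
      fun i j => continuous_const.mul (hc j i)
    rw [h1, integral_finsetSum _ fun i _ => integrable_of_continuous ν
      (continuous_finsetSum _ fun j _ => hg i j)]
    refine Finset.sum_congr rfl fun i _ => ?_
    rw [integral_finsetSum _ fun j _ => integrable_of_continuous ν (hg i j)]
    exact Finset.sum_congr rfl fun j _ => (integral_const_mul _ _).symm
  rw [h3]
  refine integral_congr_ae (Filter.Eventually.of_forall fun U => ?_)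
  have h2 : ∑ i, ∑ j, Zᴴ i j * (∑ w, (X * snapshot b U w).trace • snapshot b U w) j i =
      (Zᴴ * ∑ w, (X * snapshot b U w).trace • snapshot b U w).trace := rfl
  simp only [h2, Matrix.mul_sum, Matrix.trace_sum, Matrix.mul_smul, Matrix.trace_smul, smul_eq_mul]
  exact Finset.sum_congr rfl fun w _ => mul_comm _ _

/-- Snapshots are Hermitian, so complex conjugation exchanges the two arguments of the form in
`hs_channel`. -/
theorem hs_channel_left (ν : Measure SU2) [IsFiniteMeasure ν]
    (b : OrthonormalBasis ι ℂ (Qubits n)) (Z X : Op n) :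
    hs (channel ν b Z) X = hs Z (channel ν b X) := by
  rw [← hs_conj, hs_channel, hs_channel, Complex.star_def, ← integral_conj]
  refine integral_congr_ae (Filter.Eventually.of_forall fun U => ?_)
  simp only [map_sum, map_mul, ← Complex.star_def, star_trace_mul_snapshot,
    Matrix.conjTranspose_conjTranspose]
  exact Finset.sum_congr rfl fun w _ => mul_comm _ _

lemma channel_conjTranspose (ν : Measure SU2) [IsFiniteMeasure ν]
    (b : OrthonormalBasis ι ℂ (Qubits n)) (X : Op n) :
    channel ν b Xᴴ = (channel ν b X)ᴴ := by
  refine hs_left_injective fun Z => ?_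
  have h : hs Z (channel ν b X)ᴴ = star (hs Zᴴ (channel ν b X)) := by
    rw [hs_conj, hs, hs, Matrix.trace_mul_comm]
  rw [h, hs_channel, hs_channel, Complex.star_def, ← integral_conj]
  refine integral_congr_ae (Filter.Eventually.of_forall fun U => ?_)
  simp only [map_sum, map_mul, ← Complex.star_def, star_trace_mul_snapshot,
    Matrix.conjTranspose_conjTranspose]

/-- Conjugating the argument by `Q(V)` replaces `U` by `U V` in each snapshot, which right
invariance of the Haar measure absorbs. -/
theorem channel_conj (b : OrthonormalBasis ι ℂ (Qubits n)) (V : SU2) (X : Op n) :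
    channel haarSU2 b (Q n V * X * (Q n V)ᴴ) = Q n V * channel haarSU2 b X * (Q n V)ᴴ := by
  refine hs_left_injective fun Z => ?_
  have h1 : hs Z (Q n V * channel haarSU2 b X * (Q n V)ᴴ) =
      hs ((Q n V)ᴴ * Z * Q n V) (channel haarSU2 b X) := by
    simp only [hs, Matrix.conjTranspose_mul, Matrix.conjTranspose_conjTranspose]
    rw [← Matrix.mul_assoc, Matrix.trace_mul_comm]
    simp only [Matrix.mul_assoc]
  have h2 : ∀ (Y : Op n) (U : SU2) (w : ι), (Q n V * Y * (Q n V)ᴴ * snapshot b U w).trace =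
      (Y * snapshot b (U * V) w).trace := by
    intro Y U w
    rw [snapshot_mul, Matrix.mul_assoc, Matrix.mul_assoc, Matrix.trace_mul_comm]
    simp only [Matrix.mul_assoc]
  have h3 : Q n V * ((Q n V)ᴴ * Z * Q n V)ᴴ * (Q n V)ᴴ = Zᴴ := by
    simp only [Matrix.conjTranspose_mul, Matrix.conjTranspose_conjTranspose, Matrix.mul_assoc]
    rw [Q_mul_conjTranspose_self, Matrix.mul_one, ← Matrix.mul_assoc (Q n V),
      Q_mul_conjTranspose_self, Matrix.one_mul]
  rw [h1, hs_channel, hs_channel]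
  refine Eq.trans ?_ (integral_mul_right_haarSU2 ?_ V)
  · refine integral_congr_ae (Filter.Eventually.of_forall fun U => ?_)
    refine Finset.sum_congr rfl fun w _ => ?_
    rw [← h2, ← h2, h3]
  · exact continuous_finsetSum _ fun w _ =>
      (continuous_trace_mul_snapshot b w _).mul (continuous_trace_mul_snapshot b w _)

/-! #### Designs -/

/-- Testing the third moments on `A ⊗ A ⊗ 1`, at a diagonal entry of the last factor, reads off the
second moments. -/
lemma IsThreeDesign.integral_snapshot_mul_snapshot {ν : Measure SU2} (hν : IsThreeDesign n ν)
    (b : OrthonormalBasis ι ℂ (Qubits n)) (w : ι) (x y x' y' : Bits n) :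
    ∫ U, snapshot b U w x y * snapshot b U w x' y' ∂ν =
      ∫ U, snapshot b U w x y * snapshot b U w x' y' ∂haarSU2 := by
  set A : Op n := Matrix.vecMulVec (b w).ofLp (star (b w).ofLp) with hA
  have h := congrFun (congrFun (hν (tens ![A, A, 1])) ![x, x', 0]) ![y, y', 0]
  have key : ∀ U : SU2, ((tensorPow 3 (Q n U))ᴴ * tens ![A, A, 1] * tensorPow 3 (Q n U))
      ![x, x', 0] ![y, y', 0] = snapshot b U w x y * snapshot b U w x' y' := by
    intro U
    rw [tensorPow_eq_tens, tens_conjTranspose, tens_mul, tens_mul, tens_apply, Fin.prod_univ_three]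
    simp only [Pi.mul_apply, Matrix.cons_val_zero, Matrix.cons_val_one, Matrix.cons_val,
      Q_conjTranspose_mul_self, Matrix.one_apply_eq, mul_one]
    rfl
  simpa only [thirdMoment, Matrix.of_apply, key] using h

theorem IsThreeDesign.channel_eq {ν : Measure SU2} [IsFiniteMeasure ν] (hν : IsThreeDesign n ν)
    (b : OrthonormalBasis ι ℂ (Qubits n)) : channel ν b = channel haarSU2 b := by
  have h : ∀ (μ : Measure SU2) [IsFiniteMeasure μ] (X : Op n) (x y : Bits n),
      channel μ b X x y =
        ∑ w, ∑ i, ∑ j, X i j * ∫ U, snapshot b U w j i * snapshot b U w x y ∂μ := by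
    intro μ _ X x y
    have hc : ∀ w i j, Continuous fun U => X i j * (snapshot b U w j i * snapshot b U w x y) :=
      fun w i j => continuous_const.mul (((continuous_snapshot b w).matrix_elem j i).mul
        ((continuous_snapshot b w).matrix_elem x y))
    simp_rw [← integral_const_mul]
    simp_rw [← integral_finsetSum _ fun j _ => integrable_of_continuous μ (hc _ _ j)]
    simp_rw [← integral_finsetSum _ fun i _ => integrable_of_continuous μ
      (continuous_finsetSum _ fun j _ => hc _ i j)]
    rw [← integral_finsetSum _ fun w _ => integrable_of_continuous μ
      (continuous_finsetSum _ fun i _ => continuous_finsetSum _ fun j _ => hc w i j)]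
    refine integral_congr_ae (Filter.Eventually.of_forall fun U => ?_)
    simp only [Matrix.sum_apply, Matrix.smul_apply, smul_eq_mul, Matrix.trace, Matrix.diag_apply,
      Matrix.mul_apply, Finset.sum_mul, mul_assoc]
  ext X x y
  rw [h, h]
  simp only [hν.integral_snapshot_mul_snapshot]

end Channel

/-! ### Lower bounds for the eigenvalues of an averaged form -/

section Hilbert

variable {E : Type*} [NormedAddCommGroup E] [InnerProductSpace ℂ E] [FiniteDimensional ℂ E]

/-- In an orthonormal eigenbasis the inequality holds coordinate by coordinate. -/
lemma norm_le_norm_apply_of_eigenvalues {T : E →ₗ[ℂ] E} (hT : T.IsSymmetric) {c : ℝ} (hc : 0 ≤ c)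
    (h : ∀ μ : ℝ, Module.End.HasEigenvalue T (μ : ℂ) → 1 ≤ c * μ) (x : E) :
    ‖x‖ ≤ c * ‖T x‖ := by
  have key : ‖x‖ ^ 2 ≤ (c * ‖T x‖) ^ 2 := by
    rw [mul_pow, ← (hT.eigenvectorBasis rfl).repr.norm_map x,
      ← (hT.eigenvectorBasis rfl).repr.norm_map (T x), EuclideanSpace.norm_sq_eq,
      EuclideanSpace.norm_sq_eq, Finset.mul_sum]
    refine Finset.sum_le_sum fun i _ => ?_
    rw [hT.eigenvectorBasis_apply_self_apply rfl, norm_mul, mul_pow, ← mul_assoc]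
    refine le_mul_of_one_le_left (sq_nonneg _) ?_
    have h1 := h _ (hT.hasEigenvalue_eigenvalues rfl i)
    have h2 : ‖((hT.eigenvalues rfl i : ℝ) : ℂ)‖ ^ 2 = hT.eigenvalues rfl i ^ 2 := by
      rw [Complex.norm_real, Real.norm_eq_abs, sq_abs]
    erw [h2]
    rw [← mul_pow]
    exact one_le_pow₀ h1
  exact le_of_sq_le_sq key (by positivity)

/-- If a form is the average over a family of isometries preserving a subspace `W`, and is bounded by
`μ` on `W`, then `μ` is at least the proportion of the dimension of `W` taken by any subspace on
which the vectors `S q` form a Parseval frame. -/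
lemma finrank_le_of_average {Ω κ : Type*} [MeasurableSpace Ω] (ν : Measure Ω)
    [IsProbabilityMeasure ν] [Fintype κ] {W W₀ : Submodule ℂ E} (hW : W₀ ≤ W) {μ : ℝ}
    (S : κ → E) (A : Ω → E →ₗᵢ[ℂ] E) (hA : ∀ U, ∀ x ∈ W, A U x ∈ W)
    (hS : ∀ y ∈ W₀, ∑ q, ‖inner ℂ (S q) y‖ ^ 2 = ‖y‖ ^ 2)
    (hint : ∀ x, Integrable (fun U => ∑ q, ‖inner ℂ (S q) (A U x)‖ ^ 2) ν)
    (hμ : ∀ x ∈ W, ∫ U, ∑ q, ‖inner ℂ (S q) (A U x)‖ ^ 2 ∂ν ≤ μ * ‖x‖ ^ 2) :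
    (Module.finrank ℂ W₀ : ℝ) ≤ μ * Module.finrank ℂ W := by
  let v := stdOrthonormalBasis ℂ W
  let y := stdOrthonormalBasis ℂ W₀
  have hpt : ∀ U, (Module.finrank ℂ W₀ : ℝ) ≤ ∑ j, ∑ q, ‖inner ℂ (S q) (A U (v j : E))‖ ^ 2 := by
    intro U
    let a : W →ₗᵢ[ℂ] W :=
      { toLinearMap := (A U).toLinearMap.restrict (hA U)
        norm_map' := fun x => (A U).norm_map x }
    -- A norm-preserving endomorphism of the finite-dimensional space `W` is unitary, so it carries
    -- the orthonormal basis `v` to another one.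
    let u := v.map (a.toLinearIsometryEquiv rfl)
    have hu : ∀ j, ((u j : W) : E) = A U (v j : E) := by
      intro j
      simp only [u, OrthonormalBasis.map_apply, LinearIsometry.toLinearIsometryEquiv_apply]
      rfl
    have hP : ∀ (s : E) (w : W), inner ℂ s (w : E) = inner ℂ (W.orthogonalProjectionOnto s) w :=
      fun s w => (W.inner_orthogonalProjectionOnto_eq_of_mem_right w s).symm
    have hyo : Orthonormal ℂ fun i => (⟨(y i : E), hW (y i).2⟩ : W) := by
      have h := y.orthonormal
      rw [orthonormal_iff_ite] at h ⊢
      exact h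
    calc (Module.finrank ℂ W₀ : ℝ) = ∑ i, ‖(y i : E)‖ ^ 2 := by
          have : ∀ i, ‖(y i : E)‖ = 1 := y.orthonormal.1
          simp [this]
      _ = ∑ i, ∑ q, ‖inner ℂ (S q) (y i : E)‖ ^ 2 :=
          Finset.sum_congr rfl fun i _ => (hS _ (y i).2).symm
      _ = ∑ q, ∑ i, ‖inner ℂ (S q) (y i : E)‖ ^ 2 := Finset.sum_comm
      -- Bessel's inequality for the basis of `W₀`, orthonormal inside `W`. Parseval for `u` then
      -- makes the bound the trace of the form over `W`, for each `U` separately.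
      _ ≤ ∑ q, ‖W.orthogonalProjectionOnto (S q)‖ ^ 2 := by
          refine Finset.sum_le_sum fun q _ => ?_
          refine le_trans (le_of_eq ?_)
            (hyo.sum_inner_products_le (W.orthogonalProjectionOnto (S q)) (s := Finset.univ))
          refine Finset.sum_congr rfl fun i _ => ?_
          rw [← norm_inner_symm (W.orthogonalProjectionOnto (S q)),
            ← hP (S q) ⟨(y i : E), hW (y i).2⟩]
      _ = ∑ q, ∑ j, ‖inner ℂ (S q) (A U (v j : E))‖ ^ 2 := by
          refine Finset.sum_congr rfl fun q _ => ?_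
          rw [← u.sum_sq_norm_inner_left]
          refine Finset.sum_congr rfl fun j _ => ?_
          rw [← hP, hu]
      _ = _ := Finset.sum_comm
  calc (Module.finrank ℂ W₀ : ℝ) = ∫ _, (Module.finrank ℂ W₀ : ℝ) ∂ν := by simp
    _ ≤ ∫ U, ∑ j, ∑ q, ‖inner ℂ (S q) (A U (v j : E))‖ ^ 2 ∂ν :=
        integral_mono (integrable_const _) (integrable_finsetSum _ fun j _ => hint _) hpt
    _ = ∑ j, ∫ U, ∑ q, ‖inner ℂ (S q) (A U (v j : E))‖ ^ 2 ∂ν :=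
        integral_finsetSum _ fun j _ => hint _
    _ ≤ ∑ j, μ * ‖(v j : E)‖ ^ 2 := Finset.sum_le_sum fun j _ => hμ _ (v j).2
    _ = μ * Module.finrank ℂ W := by
        have : ∀ i, ‖(v i : E)‖ = 1 := v.orthonormal.1
        simp [this, mul_comm]

end Hilbert

/-! ### Weights of matrices under the adjoint action of a spin representation -/

section Weights

variable {d : ℕ}

/-- The commutator map `X ↦ A X - X A`. -/
def adj (A : Matrix (Fin d) (Fin d) ℂ) :
    Matrix (Fin d) (Fin d) ℂ →ₗ[ℂ] Matrix (Fin d) (Fin d) ℂ :=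
  LinearMap.mulLeft ℂ A - LinearMap.mulRight ℂ A

lemma adj_apply (A X : Matrix (Fin d) (Fin d) ℂ) : adj A X = A * X - X * A := rfl

lemma adj_add (A B : Matrix (Fin d) (Fin d) ℂ) : adj (A + B) = adj A + adj B := by
  ext1 X; simp only [adj_apply, LinearMap.add_apply]; noncomm_ring

lemma adj_sub (A B : Matrix (Fin d) (Fin d) ℂ) : adj (A - B) = adj A - adj B := by
  ext1 X; simp only [adj_apply, LinearMap.sub_apply]; noncomm_ring

lemma adj_smul (c : ℂ) (A : Matrix (Fin d) (Fin d) ℂ) : adj (c • A) = c • adj A := by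
  ext1 X
  simp only [adj_apply, LinearMap.smul_apply, Matrix.smul_mul, Matrix.mul_smul, smul_sub]

/-- The part of a matrix on the diagonal `q - p = m`. -/
def weightPart (m : ℤ) : Matrix (Fin d) (Fin d) ℂ →ₗ[ℂ] Matrix (Fin d) (Fin d) ℂ where
  toFun X := Matrix.of fun p q => if (q : ℤ) - p = m then X p q else 0
  map_add' X Y := by ext p q; simp only [Matrix.of_apply, Matrix.add_apply]; split_ifs <;> simp
  map_smul' c X := by
    ext p q; simp only [Matrix.of_apply, Matrix.smul_apply, RingHom.id_apply]; split_ifs <;> simp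

lemma weightPart_apply (m : ℤ) (X : Matrix (Fin d) (Fin d) ℂ) (p q : Fin d) :
    weightPart m X p q = if (q : ℤ) - p = m then X p q else 0 := rfl

/-- The matrices supported on the diagonal `q - p = m`. -/
def weightSpace (d : ℕ) (m : ℤ) : Submodule ℂ (Matrix (Fin d) (Fin d) ℂ) where
  carrier := {X | ∀ p q : Fin d, (q : ℤ) - p ≠ m → X p q = 0}
  add_mem' hX hY p q h := by rw [Matrix.add_apply, hX p q h, hY p q h, add_zero]
  zero_mem' _ _ _ := rfl
  smul_mem' c X hX p q h := by rw [Matrix.smul_apply, hX p q h, smul_zero]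

lemma weightPart_mem (m : ℤ) (X : Matrix (Fin d) (Fin d) ℂ) :
    weightPart m X ∈ weightSpace d m := fun p q h => by
  rw [weightPart_apply, if_neg h]

lemma weightPart_of_mem {m : ℤ} {X : Matrix (Fin d) (Fin d) ℂ} (hX : X ∈ weightSpace d m) (k : ℤ) :
    weightPart k X = if m = k then X else 0 := by
  ext p q
  rw [weightPart_apply]
  by_cases h : (q : ℤ) - p = m
  · subst h; split_ifs <;> rfl
  · rw [hX p q h]; split_ifs <;> simp [hX p q h]

lemma mul_mem_weightSpace {m k : ℤ} {X Y : Matrix (Fin d) (Fin d) ℂ} (hX : X ∈ weightSpace d m)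
    (hY : Y ∈ weightSpace d k) : X * Y ∈ weightSpace d (m + k) := by
  intro p q h
  rw [Matrix.mul_apply]
  refine Finset.sum_eq_zero fun r _ => ?_
  by_cases h1 : (r : ℤ) - p = m
  · rw [hY r q (by omega), mul_zero]
  · rw [hX p r h1, zero_mul]

lemma adj_mem_weightSpace {m k : ℤ} {X Y : Matrix (Fin d) (Fin d) ℂ} (hX : X ∈ weightSpace d m)
    (hY : Y ∈ weightSpace d k) : adj X Y ∈ weightSpace d (k + m) := by
  rw [adj_apply]
  refine Submodule.sub_mem _ ?_ (mul_mem_weightSpace hY hX)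
  rw [add_comm]
  exact mul_mem_weightSpace hX hY

lemma conjTranspose_mem_weightSpace {m : ℤ} {X : Matrix (Fin d) (Fin d) ℂ}
    (hX : X ∈ weightSpace d m) : Xᴴ ∈ weightSpace d (-m) := by
  intro p q h
  rw [Matrix.conjTranspose_apply, hX q p (by omega), star_zero]

/-- A matrix commuting with a regular nilpotent upper triangular matrix is upper triangular. -/
lemma eq_zero_of_adj_eq_zero {E : Matrix (Fin d) (Fin d) ℂ} (hE : E ∈ weightSpace d 1)
    (hE0 : ∀ p q : Fin d, (q : ℤ) - p = 1 → E p q ≠ 0) {X : Matrix (Fin d) (Fin d) ℂ}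
    (hX : adj E X = 0) (a q : Fin d) (haq : q < a) : X a q = 0 := by
  obtain ⟨k, hk⟩ : ∃ k, (q : ℕ) = k := ⟨_, rfl⟩
  induction k generalizing a q with
  | zero =>
    -- Compare the entries `(a - 1, q)` of `E X = X E`. The left one is `E (a - 1) a * X a q`; the
    -- right one involves only column `q - 1` of `X`, which does not exist here and is covered by
    -- induction below.
    let p : Fin d := ⟨a - 1, by omega⟩
    have hp : (a : ℤ) - p = 1 := by simp only [p]; omega
    have h : (E * X) p q = (X * E) p q := by
      rw [sub_eq_zero.mp ((adj_apply E X).symm.trans hX)]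
    rw [Matrix.mul_apply, Matrix.mul_apply,
      Finset.sum_eq_single a, Finset.sum_eq_zero] at h
    · exact (mul_eq_zero.mp h).resolve_left (hE0 p a hp)
    · intro r _
      rw [hE r q (by omega), mul_zero]
    · intro r _ hr
      rw [hE p r (by omega), zero_mul]
    · simp
  | succ k ih =>
    let p : Fin d := ⟨a - 1, by omega⟩
    have hp : (a : ℤ) - p = 1 := by simp only [p]; omega
    have h : (E * X) p q = (X * E) p q := by
      rw [sub_eq_zero.mp ((adj_apply E X).symm.trans hX)]
    rw [Matrix.mul_apply, Matrix.mul_apply,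
      Finset.sum_eq_single a, Finset.sum_eq_zero] at h
    · exact (mul_eq_zero.mp h).resolve_left (hE0 p a hp)
    · intro r _
      by_cases hr : (q : ℤ) - r = 1
      · rw [ih p r (by omega) (by omega), zero_mul]
      · rw [hE r q hr, mul_zero]
    · intro r _ hr
      rw [hE p r (by omega), zero_mul]
    · simp

variable {E : Matrix (Fin d) (Fin d) ℂ}

/-- The commutant of `E` is upper triangular, so `adj E` is injective on strictly negative weights.
The condition `m + k ≤ 0` ensures that each of the `k` applications starts from such a weight. -/
lemma eq_zero_of_adj_pow_eq_zero (hE : E ∈ weightSpace d 1)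
    (hE0 : ∀ p q : Fin d, (q : ℤ) - p = 1 → E p q ≠ 0) (k : ℕ) {m : ℤ}
    {X : Matrix (Fin d) (Fin d) ℂ} (hX : X ∈ weightSpace d m) (hm : m + k ≤ 0)
    (h : (adj E ^ k) X = 0) : X = 0 := by
  induction k generalizing m X with
  | zero => simpa using h
  | succ k ih =>
    rw [pow_succ, Module.End.mul_apply] at h
    have h1 := ih (adj_mem_weightSpace hE hX) (by push_cast at hm; omega) h
    ext p q
    by_cases hpq : (q : ℤ) - p = m
    · exact eq_zero_of_adj_eq_zero hE hE0 h1 p q (by push_cast at hm; omega)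
    · exact hX p q hpq

lemma adj_conjTranspose_pow (k : ℕ) (X : Matrix (Fin d) (Fin d) ℂ) :
    ((adj Eᴴ ^ k) X)ᴴ = (-1 : ℂ) ^ k • (adj E ^ k) Xᴴ := by
  induction k generalizing X with
  | zero => simp
  | succ k ih =>
    have h : (adj Eᴴ X)ᴴ = (-1 : ℂ) • adj E Xᴴ := by
      simp [adj_apply, Matrix.conjTranspose_sub, Matrix.conjTranspose_mul]
    rw [pow_succ, Module.End.mul_apply, ih, h, map_smul, smul_smul, pow_succ, pow_succ,
      Module.End.mul_apply]

lemma eq_zero_of_adj_conjTranspose_pow_eq_zero (hE : E ∈ weightSpace d 1)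
    (hE0 : ∀ p q : Fin d, (q : ℤ) - p = 1 → E p q ≠ 0) (k : ℕ) {m : ℤ}
    {X : Matrix (Fin d) (Fin d) ℂ} (hX : X ∈ weightSpace d m) (hm : 0 ≤ m - k)
    (h : (adj Eᴴ ^ k) X = 0) : X = 0 := by
  have h1 := adj_conjTranspose_pow (E := E) k X
  rw [h, Matrix.conjTranspose_zero, eq_comm, smul_eq_zero] at h1
  have h2 := eq_zero_of_adj_pow_eq_zero hE hE0 k (conjTranspose_mem_weightSpace hX) (by omega)
    (h1.resolve_left (by simp))
  simpa using h2

lemma adj_pow_mem_weightSpace {m k : ℤ} {X Y : Matrix (Fin d) (Fin d) ℂ} (hX : X ∈ weightSpace d m)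
    (hY : Y ∈ weightSpace d k) (j : ℕ) : (adj X ^ j) Y ∈ weightSpace d (k + j * m) := by
  induction j with
  | zero => simpa using hY
  | succ j ih =>
    rw [pow_succ', Module.End.mul_apply]
    have := adj_mem_weightSpace hX ih
    convert this using 1
    push_cast
    ring_nf

/-- In a space of matrices invariant under the adjoint action of a spin representation, the
zero weight space has the largest dimension among the weight spaces. -/
theorem finrank_le_mul_finrank_weightSpace_zero (hd : 0 < d) (hE : E ∈ weightSpace d 1)
    (hE0 : ∀ p q : Fin d, (q : ℤ) - p = 1 → E p q ≠ 0)
    {W : Submodule ℂ (Matrix (Fin d) (Fin d) ℂ)} (hWE : ∀ X ∈ W, adj E X ∈ W)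
    (hWF : ∀ X ∈ W, adj Eᴴ X ∈ W) (hWp : ∀ m, ∀ X ∈ W, weightPart m X ∈ W) :
    Module.finrank ℂ W ≤ (2 * d - 1) * Module.finrank ℂ (W ⊓ weightSpace d 0 : Submodule ℂ _) := by
  let I := Finset.Icc (-((d : ℤ) - 1)) (d - 1)
  have hpow : ∀ {A : Matrix (Fin d) (Fin d) ℂ}, (∀ X ∈ W, adj A X ∈ W) → ∀ (j : ℕ),
      ∀ X ∈ W, (adj A ^ j) X ∈ W := by
    intro A hA j
    induction j with
    | zero => intro X hX; simpa using hX
    | succ j ih =>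
      intro X hX
      rw [pow_succ', Module.End.mul_apply]
      exact hA _ (ih X hX)
  have hF : Eᴴ ∈ weightSpace d (-1) := conjTranspose_mem_weightSpace hE
  -- Each weight part is moved to weight zero, up by `E` if `m ≤ 0` and down by its adjoint if `m ≥
  -- 0`. Truncation in `toNat` makes the other exponent vanish.
  let φ : ℤ → Matrix (Fin d) (Fin d) ℂ →ₗ[ℂ] Matrix (Fin d) (Fin d) ℂ := fun m =>
    (adj E ^ (-m).toNat) ∘ₗ (adj Eᴴ ^ m.toNat) ∘ₗ weightPart m
  have hφ : ∀ m, ∀ X ∈ W, φ m X ∈ W ⊓ weightSpace d 0 := by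
    intro m X hX
    refine ⟨hpow hWE _ _ (hpow hWF _ _ (hWp m X hX)), ?_⟩
    have := adj_pow_mem_weightSpace hE (adj_pow_mem_weightSpace hF (weightPart_mem m X) m.toNat)
      (-m).toNat
    have h0 : m + (m.toNat : ℤ) * -1 + ((-m).toNat : ℤ) * 1 = 0 := by omega
    rwa [h0] at this
  have hφ0 : ∀ m X, φ m X = 0 → weightPart m X = 0 := by
    intro m X h
    rcases le_total m 0 with hm | hm
    · have h1 : m.toNat = 0 := by omega
      simp only [φ, LinearMap.comp_apply, h1, pow_zero, Module.End.one_apply] at h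
      exact eq_zero_of_adj_pow_eq_zero hE hE0 _ (weightPart_mem m X) (by omega) h
    · have h1 : (-m).toNat = 0 := by omega
      simp only [φ, LinearMap.comp_apply, h1, pow_zero, Module.End.one_apply] at h
      exact eq_zero_of_adj_conjTranspose_pow_eq_zero hE hE0 _ (weightPart_mem m X) (by omega) h
  -- Indexing by `I`, with its `2 d - 1` elements, loses nothing: every matrix entry lies on a
  -- diagonal in this range.
  let Φ : W →ₗ[ℂ] (I → (W ⊓ weightSpace d 0 : Submodule ℂ _)) :=
    LinearMap.pi fun m => ((φ m).domRestrict W).codRestrict _ fun X => hφ m X X.2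
  have hinj : Function.Injective Φ := by
    rw [← LinearMap.ker_eq_bot, LinearMap.ker_eq_bot']
    intro X hX
    apply Subtype.ext
    ext p q
    have hm : (q : ℤ) - p ∈ I := by
      simp only [I, Finset.mem_Icc]; omega
    have h1 : φ ((q : ℤ) - p) X = 0 := congrArg Subtype.val (congrFun hX ⟨_, hm⟩)
    have h2 := congrFun (congrFun (hφ0 _ _ h1) p) q
    rwa [weightPart_apply, if_pos rfl] at h2
  have h := LinearMap.finrank_le_finrank_of_injective hinj
  rw [Module.finrank_pi_fintype, Finset.sum_const, Finset.card_univ, Fintype.card_coe,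
    Int.card_Icc, smul_eq_mul] at h
  have h3 : (((d : ℤ) - 1 + 1 - -((d : ℤ) - 1)).toNat) = 2 * d - 1 := by omega
  rwa [h3] at h

/-- A linear map commuting with the adjoint action of a spin representation preserves weights. -/
lemma weightPart_comm {M : Matrix (Fin d) (Fin d) ℂ →ₗ[ℂ] Matrix (Fin d) (Fin d) ℂ}
    (hME : ∀ X, M (adj E X) = adj E (M X)) (hMF : ∀ X, M (adj Eᴴ X) = adj Eᴴ (M X))
    (hEF : E * Eᴴ - Eᴴ * E = Matrix.diagonal fun p : Fin d => (d : ℂ) - 1 - 2 * (p : ℕ))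
    (m : ℤ) (X : Matrix (Fin d) (Fin d) ℂ) : M (weightPart m X) = weightPart m (M X) := by
  set H := Matrix.diagonal fun p : Fin d => (d : ℂ) - 1 - 2 * (p : ℕ) with hH
  -- By the Jacobi identity `M` also commutes with `adj H`, whose eigenspaces are the weight spaces.
  have hJ : ∀ X, adj H X = adj E (adj Eᴴ X) - adj Eᴴ (adj E X) := by
    intro X
    rw [← hEF]
    simp only [adj_apply]
    noncomm_ring
  have hMH : ∀ X, M (adj H X) = adj H (M X) := by
    intro X
    rw [hJ, hJ, map_sub, hME, hMF, hMF, hME]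
  have hHX : ∀ (X : Matrix (Fin d) (Fin d) ℂ) p q,
      adj H X p q = 2 * ((q : ℕ) - (p : ℕ) : ℂ) * X p q := by
    intro X p q
    rw [adj_apply, Matrix.sub_apply, hH, Matrix.diagonal_mul, Matrix.mul_diagonal]
    ring
  have hmem : ∀ k X, X ∈ weightSpace d k ↔ adj H X = (2 * k : ℂ) • X := by
    intro k X
    constructor
    · intro hX
      ext p q
      rw [hHX, Matrix.smul_apply, smul_eq_mul]
      by_cases h : (q : ℤ) - p = k
      · rw [← h]; push_cast; ring
      · rw [hX p q h]; ring
    · intro hX p q h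
      have h1 := congrFun (congrFun hX p) q
      rw [hHX, Matrix.smul_apply, smul_eq_mul, ← sub_eq_zero, ← sub_mul, mul_eq_zero] at h1
      refine h1.resolve_left fun h2 => h ?_
      have h3 : (((q : ℤ) - p - k : ℤ) : ℂ) = 0 := by
        push_cast; linear_combination h2 / 2
      have := Int.cast_eq_zero.mp h3
      omega
  have hMmem : ∀ k, ∀ X ∈ weightSpace d k, M X ∈ weightSpace d k := by
    intro k X hX
    rw [hmem] at hX ⊢
    rw [← hMH, hX, map_smul]
  suffices M ∘ₗ weightPart m = weightPart m ∘ₗ M from LinearMap.congr_fun this X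
  -- It suffices to test on matrix units, each of which has a single weight.
  refine Matrix.ext_linearMap _ fun p q => LinearMap.ext fun c => ?_
  have hs : Matrix.single p q c ∈ weightSpace d ((q : ℤ) - p) := by
    intro i j h
    refine Matrix.single_apply_of_ne _ _ _ _ _ ?_
    rintro ⟨rfl, rfl⟩
    exact h rfl
  simp only [LinearMap.comp_apply, Matrix.singleLinearMap_apply]
  rw [weightPart_of_mem hs, weightPart_of_mem (hMmem _ _ hs)]
  split_ifs <;> simp

end Weights

/-! ### Equivariant maps on the matrices over a spin representation -/

section Equivariant

variable {d : ℕ}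

lemma hasDerivAt_mul_mul {κ τ σ σ' : Type*} [Fintype κ] [Fintype τ]
    {γ : ℝ → Matrix κ τ ℂ} {A : Matrix κ τ ℂ}
    (hγ : ∀ a b, HasDerivAt (fun θ => γ θ a b) (A a b) 0) (L : Matrix σ κ ℂ) (R : Matrix τ σ' ℂ)
    (x : σ) (y : σ') : HasDerivAt (fun θ => (L * γ θ * R) x y) ((L * A * R) x y) 0 := by
  simp only [Matrix.mul_apply]
  exact HasDerivAt.fun_sum fun j _ =>
    (HasDerivAt.fun_sum fun i _ => (hγ i j).const_mul (L x i)).mul_const (R j y)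

/-- A linear map equivariant under conjugation by a one-parameter family of matrices commutes with
the commutator with its derivative. -/
lemma adj_comm_of_conj_comm {M : Matrix (Fin d) (Fin d) ℂ →ₗ[ℂ] Matrix (Fin d) (Fin d) ℂ}
    {γ : ℝ → Matrix (Fin d) (Fin d) ℂ} {A : Matrix (Fin d) (Fin d) ℂ} (h0 : γ 0 = 1)
    (hγ : ∀ a b, HasDerivAt (fun θ => γ θ a b) (A a b) 0) (hA : Aᴴ = -A)
    (hM : ∀ θ X, M (γ θ * X * (γ θ)ᴴ) = γ θ * M X * (γ θ)ᴴ) (X : Matrix (Fin d) (Fin d) ℂ) :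
    M (adj A X) = adj A (M X) := by
  have hder : ∀ X p q, HasDerivAt (fun θ => (γ θ * X * (γ θ)ᴴ) p q) (adj A X p q) 0 := by
    intro X p q
    have h1 : adj A X = A * X * (1 : Matrix (Fin d) (Fin d) ℂ)ᴴ +
        (1 : Matrix (Fin d) (Fin d) ℂ) * X * Aᴴ := by
      rw [hA, adj_apply]; simp [sub_eq_add_neg]
    rw [h1, Matrix.add_apply, Matrix.mul_apply, Matrix.mul_apply, ← Finset.sum_add_distrib]
    simp only [Matrix.mul_apply (M := γ _ * X)]
    refine HasDerivAt.fun_sum fun j _ => ?_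
    have h2 := hasDerivAt_mul_mul hγ (1 : Matrix (Fin d) (Fin d) ℂ) X p j
    simp only [Matrix.one_mul] at h2
    have h3 : HasDerivAt (fun θ => (γ θ)ᴴ j q) (Aᴴ j q) 0 := (hγ q j).star
    have h4 := h2.mul h3
    simp only [h0] at h4
    exact h4
  ext p q
  -- Expanding `M` in matrix units allows differentiation under `M` entry by entry.
  have hexp : ∀ Y : Matrix (Fin d) (Fin d) ℂ,
      M Y p q = ∑ i, ∑ j, Y i j * M (Matrix.single i j 1) p q := by
    intro Y
    conv_lhs => rw [Matrix.matrix_eq_sum_single Y]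
    simp only [map_sum, Matrix.sum_apply]
    refine Finset.sum_congr rfl fun i _ => Finset.sum_congr rfl fun j _ => ?_
    have : Matrix.single i j (Y i j) = Y i j • Matrix.single i j (1 : ℂ) := by
      rw [Matrix.smul_single, smul_eq_mul, mul_one]
    rw [this, map_smul, Matrix.smul_apply, smul_eq_mul]
  have h1 : HasDerivAt (fun θ => M (γ θ * X * (γ θ)ᴴ) p q) (M (adj A X) p q) 0 := by
    rw [hexp]
    simp only [hexp (γ _ * X * (γ _)ᴴ)]
    exact HasDerivAt.fun_sum fun i _ => HasDerivAt.fun_sum fun j _ => (hder X i j).mul_const _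
  simp only [hM] at h1
  exact h1.unique (hder (M X) p q)

lemma hs_self_eq {d : Type*} [Fintype d] (X : Matrix d d ℂ) :
    hs X X = ((∑ q, ∑ p, ‖X p q‖ ^ 2 : ℝ) : ℂ) := by
  simp only [hs, Matrix.trace, Matrix.diag_apply, Matrix.mul_apply, Matrix.conjTranspose_apply]
  push_cast
  refine Finset.sum_congr rfl fun q _ => Finset.sum_congr rfl fun p _ => ?_
  rw [Complex.star_def, Complex.conj_mul']

lemma hs_conj_isometry {d : Type*} [Fintype d] [DecidableEq d] {V : Matrix d d ℂ}
    (hV : Vᴴ * V = 1) (Y Z : Matrix d d ℂ) : hs (V * Y * Vᴴ) (V * Z * Vᴴ) = hs Y Z := by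
  simp only [hs, Matrix.conjTranspose_mul, Matrix.conjTranspose_conjTranspose]
  have h1 : V * (Yᴴ * Vᴴ) * (V * Z * Vᴴ) = V * (Yᴴ * (Vᴴ * V) * Z * Vᴴ) := by
    simp only [Matrix.mul_assoc]
  rw [h1, hV, Matrix.mul_one, Matrix.trace_mul_comm, Matrix.mul_assoc, hV, Matrix.mul_one]

lemma norm_apply_sq_le_hs {d : Type*} [Fintype d] (X : Matrix d d ℂ) (p q : d) :
    ‖X p q‖ ^ 2 ≤ (hs X X).re := by
  rw [hs_self_eq, Complex.ofReal_re]
  refine le_trans (Finset.single_le_sum (f := fun p => ‖X p q‖ ^ 2)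
    (fun _ _ => sq_nonneg _) (Finset.mem_univ p)) ?_
  exact Finset.single_le_sum (f := fun q => ∑ p, ‖X p q‖ ^ 2)
    (fun _ _ => Finset.sum_nonneg fun _ _ => sq_nonneg _) (Finset.mem_univ q)

/-- An equivariant self-adjoint map on the matrices over a spin representation, bounded below by the
averaged norm of the diagonal, has the smallest eigenvalue at least `1 / (2 d - 1)`. -/
theorem hs_le_of_equivariant (hd : 0 < d) {E : Matrix (Fin d) (Fin d) ℂ} (hE : E ∈ weightSpace d 1)
    (hE0 : ∀ p q : Fin d, (q : ℤ) - p = 1 → E p q ≠ 0)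
    (hEF : E * Eᴴ - Eᴴ * E = Matrix.diagonal fun p : Fin d => (d : ℂ) - 1 - 2 * (p : ℕ))
    {M : Matrix (Fin d) (Fin d) ℂ →ₗ[ℂ] Matrix (Fin d) (Fin d) ℂ}
    (hsym : ∀ X Y, hs (M X) Y = hs X (M Y))
    (hME : ∀ X, M (adj E X) = adj E (M X)) (hMF : ∀ X, M (adj Eᴴ X) = adj Eᴴ (M X))
    {D : SU2 → Matrix (Fin d) (Fin d) ℂ} (hDu : ∀ U, (D U)ᴴ * D U = 1) (hDc : Continuous D)
    (hMD : ∀ U X, M (D U * X * (D U)ᴴ) = D U * M X * (D U)ᴴ)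
    (hM : ∀ X, ∫ U, ∑ q, ‖(D U * X * (D U)ᴴ) q q‖ ^ 2 ∂haarSU2 ≤ (hs X (M X)).re)
    (X : Matrix (Fin d) (Fin d) ℂ) :
    (hs X X).re ≤ (2 * d - 1) ^ 2 * (hs (M X) (M X)).re := by
  let i₁ : NormedAddCommGroup (Matrix (Fin d) (Fin d) ℂ) :=
    Matrix.toMatrixNormedAddCommGroup (1 : Matrix (Fin d) (Fin d) ℂ) Matrix.PosDef.one
  let i₂ : InnerProductSpace ℂ (Matrix (Fin d) (Fin d) ℂ) :=
    Matrix.toMatrixInnerProductSpace (1 : Matrix (Fin d) (Fin d) ℂ) Matrix.PosDef.one.posSemidef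
  have hin : ∀ A B : Matrix (Fin d) (Fin d) ℂ, inner ℂ A B = hs A B := by
    intro A B
    change (B * 1 * Aᴴ).trace = (Aᴴ * B).trace
    rw [Matrix.mul_one, Matrix.trace_mul_comm]
  have hnorm : ∀ A : Matrix (Fin d) (Fin d) ℂ, ‖A‖ ^ 2 = (hs A A).re := by
    intro A
    rw [← hin, inner_self_eq_norm_sq_to_K]
    norm_cast
  have hT : M.IsSymmetric := fun A B => by rw [hin, hin, hsym]
  have hd' : (0 : ℝ) ≤ 2 * d - 1 := by
    have : (1 : ℝ) ≤ d := by exact_mod_cast hd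
    linarith
  let A : SU2 → Matrix (Fin d) (Fin d) ℂ →ₗᵢ[ℂ] Matrix (Fin d) (Fin d) ℂ := fun U =>
    { toLinearMap := LinearMap.mulRight ℂ (D U)ᴴ ∘ₗ LinearMap.mulLeft ℂ (D U)
      norm_map' := fun Y => by
        have h1 : ‖D U * Y * (D U)ᴴ‖ ^ 2 = ‖Y‖ ^ 2 := by
          rw [hnorm, hnorm, hs_conj_isometry (hDu U)]
        exact (sq_eq_sq₀ (norm_nonneg _) (norm_nonneg _)).mp h1 }
  have hA : ∀ U Y, A U Y = D U * Y * (D U)ᴴ := fun U Y => rfl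
  have hSin : ∀ (q : Fin d) (Y : Matrix (Fin d) (Fin d) ℂ),
      inner ℂ (Matrix.single q q (1 : ℂ)) Y = Y q q := by
    intro q Y
    rw [hin, hs, Matrix.conjTranspose_single, star_one, Matrix.trace_single_mul, one_smul]
  have key : ∀ μ : ℝ, Module.End.HasEigenvalue M (μ : ℂ) → 1 ≤ (2 * d - 1 : ℝ) * μ := by
    intro μ hμ
    set W := Module.End.eigenspace M (μ : ℂ) with hWdef
    have hW : ∀ Y, Y ∈ W ↔ M Y = (μ : ℂ) • Y := fun Y => Module.End.mem_eigenspace_iff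
    have hpres : ∀ {L : Matrix (Fin d) (Fin d) ℂ →ₗ[ℂ] Matrix (Fin d) (Fin d) ℂ},
        (∀ Y, M (L Y) = L (M Y)) → ∀ Y ∈ W, L Y ∈ W := by
      intro L hL Y hY
      rw [hW] at hY ⊢
      rw [hL, hY, map_smul]
    have h1 := finrank_le_mul_finrank_weightSpace_zero hd hE hE0 (W := W) (hpres hME) (hpres hMF)
      fun m => hpres (weightPart_comm hME hMF hEF m)
    -- The frame consists of the diagonal matrix units: they see the diagonal of a matrix, which is
    -- all of it in weight zero.
    have h2 := finrank_le_of_average haarSU2 (W := W) (W₀ := W ⊓ weightSpace d 0) inf_le_left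
      (μ := μ) (fun q => Matrix.single q q (1 : ℂ)) A (fun U => hpres (L := (A U).toLinearMap)
        (hMD U)) ?_ ?_ ?_
    · have hpos : (0 : ℝ) < Module.finrank ℂ W := by
        have : Nontrivial W := Submodule.nontrivial_iff_ne_bot.mpr hμ
        exact_mod_cast Module.finrank_pos
      have h3 : (Module.finrank ℂ W : ℝ) ≤
          (2 * d - 1) * Module.finrank ℂ (W ⊓ weightSpace d 0 : Submodule ℂ _) := by
        have h4 : ((2 * d - 1 : ℕ) : ℝ) = 2 * d - 1 := by
          rw [Nat.cast_sub (by omega)]; push_cast; ring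
        rw [← h4]
        exact_mod_cast h1
      -- Combining the two dimension counts and cancelling `dim W > 0` gives `1 ≤ (2 d - 1) μ`.
      have h5 : (Module.finrank ℂ W : ℝ) ≤ ((2 * d - 1) * μ) * Module.finrank ℂ W :=
        h3.trans (by rw [mul_assoc]; exact mul_le_mul_of_nonneg_left h2 hd')
      exact le_of_mul_le_mul_right (by rwa [one_mul]) hpos
    · intro Y hY
      rw [hnorm, hs_self_eq, Complex.ofReal_re]
      refine Finset.sum_congr rfl fun q _ => ?_
      rw [hSin, Finset.sum_eq_single q]
      · intro p _ hp
        rw [hY.2 p q (by omega), norm_zero]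
        simp
      · simp
    · intro Y
      simp only [hSin, hA]
      refine integrable_of_continuous _ (continuous_finsetSum _ fun q _ => ?_)
      have : Continuous fun U => (D U * Y * (D U)ᴴ) q q :=
        Continuous.matrix_elem
          ((hDc.matrix_mul continuous_const).matrix_mul hDc.matrix_conjTranspose) q q
      exact this.norm.pow 2
    · intro Y hY
      simp only [hSin, hA]
      refine (hM Y).trans (le_of_eq ?_)
      rw [(hW Y).mp hY, hnorm]
      simp [hs]
  have h := norm_le_norm_apply_of_eigenvalues hT hd' key X
  rw [← hnorm, ← hnorm, ← mul_pow]
  exact pow_le_pow_left₀ (norm_nonneg _) h 2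

end Equivariant

/-! ### Irreducible blocks of an orthonormal basis -/

section Block

variable {n d : ℕ} {ι : Type*} [Fintype ι]

/-- The isometry whose columns are the vectors `b (w q)`. -/
def frame (b : OrthonormalBasis ι ℂ (Qubits n)) (w : Fin d → ι) : Matrix (Bits n) (Fin d) ℂ :=
  Matrix.of fun x q => b (w q) x

/-- The vectors `b (w q)` span a representation of `SU(2)` and have the weights of the
`d`-dimensional irreducible one. -/
structure IsSpinBlock (b : OrthonormalBasis ι ℂ (Qubits n)) (w : Fin d → ι) : Prop where
  pos : 0 < d
  injective : Function.Injective w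
  Q_mul_frame : ∀ U, Q n U * frame b w = frame b w * ((frame b w)ᴴ * Q n U * frame b w)
  Jz_mul_frame : Jz n * frame b w =
    frame b w * Matrix.diagonal fun q : Fin d => ((d : ℂ) - 1) / 2 - (q : ℕ)

lemma star_dotProduct_basis [DecidableEq ι] (b : OrthonormalBasis ι ℂ (Qubits n)) (v w : ι) :
    star (b v).ofLp ⬝ᵥ (b w).ofLp = if v = w then 1 else 0 := by
  rw [← orthonormal_iff_ite.mp b.orthonormal v w, EuclideanSpace.inner_eq_star_dotProduct,
    dotProduct_comm]

lemma frame_conjTranspose_mulVec_basis [DecidableEq ι] (b : OrthonormalBasis ι ℂ (Qubits n))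
    (w : Fin d → ι) (v : ι) (q : Fin d) :
    ((frame b w)ᴴ *ᵥ (b v).ofLp) q = if w q = v then 1 else 0 :=
  star_dotProduct_basis b (w q) v

lemma frame_conjTranspose_mul_frame (b : OrthonormalBasis ι ℂ (Qubits n)) {w : Fin d → ι}
    (hw : Function.Injective w) : (frame b w)ᴴ * frame b w = 1 := by
  classical
  ext p q
  refine (frame_conjTranspose_mulVec_basis b w (w q) p).trans ?_
  rw [Matrix.one_apply]
  simp only [hw.eq_iff]

lemma trace_mul_snapshot (b : OrthonormalBasis ι ℂ (Qubits n)) (U : SU2) (v : ι) (X : Op n) :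
    (X * snapshot b U v).trace =
      star (b v).ofLp ⬝ᵥ ((Q n U * X * (Q n U)ᴴ) *ᵥ (b v).ofLp) := by
  rw [snapshot, ← Matrix.mul_assoc, Matrix.trace_mul_comm, ← Matrix.mul_assoc, ← Matrix.mul_assoc,
    Matrix.mul_vecMulVec, Matrix.trace_vecMulVec, dotProduct_comm]

/-- The action of `SU(2)` on a block. -/
def blockRep (b : OrthonormalBasis ι ℂ (Qubits n)) (w : Fin d → ι) (U : SU2) :
    Matrix (Fin d) (Fin d) ℂ :=
  (frame b w)ᴴ * Q n U * frame b w

/-- The compression of the measurement channel to a block. -/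
def blockChannel (b : OrthonormalBasis ι ℂ (Qubits n)) (w : Fin d → ι) :
    Matrix (Fin d) (Fin d) ℂ →ₗ[ℂ] Matrix (Fin d) (Fin d) ℂ where
  toFun Y := (frame b w)ᴴ * channel haarSU2 b (frame b w * Y * (frame b w)ᴴ) * frame b w
  map_add' X Y := by
    simp only [Matrix.mul_add, Matrix.add_mul, map_add]
  map_smul' c X := by
    simp only [Matrix.mul_smul, Matrix.smul_mul, map_smul, RingHom.id_apply]

lemma blockChannel_apply (b : OrthonormalBasis ι ℂ (Qubits n)) (w : Fin d → ι)
    (Y : Matrix (Fin d) (Fin d) ℂ) : blockChannel b w Y =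
      (frame b w)ᴴ * channel haarSU2 b (frame b w * Y * (frame b w)ᴴ) * frame b w := rfl

namespace IsSpinBlock

variable {b : OrthonormalBasis ι ℂ (Qubits n)} {w : Fin d → ι} (h : IsSpinBlock b w)

include h

lemma frame_conjTranspose_mul_frame : (frame b w)ᴴ * frame b w = 1 :=
  SU2Shadows.frame_conjTranspose_mul_frame b h.injective

lemma Q_mul_frame' (U : SU2) : Q n U * frame b w = frame b w * blockRep b w U := h.Q_mul_frame U

omit h in
lemma blockRep_conjTranspose (U : SU2) : (blockRep b w U)ᴴ = blockRep b w U⁻¹ := by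
  simp only [blockRep, Matrix.conjTranspose_mul, Matrix.conjTranspose_conjTranspose,
    Q_conjTranspose, Matrix.mul_assoc]

/-- Adjoint of the intertwining relation at `U⁻¹`: by unitarity the complement of the block is
invariant too. -/
lemma frame_conjTranspose_mul_Q (U : SU2) :
    (frame b w)ᴴ * Q n U = blockRep b w U * (frame b w)ᴴ := by
  have h1 := congrArg Matrix.conjTranspose (h.Q_mul_frame' U⁻¹)
  rw [Matrix.conjTranspose_mul, Matrix.conjTranspose_mul, Q_conjTranspose, blockRep_conjTranspose,
    inv_inv] at h1
  exact h1

lemma blockRep_unitary (U : SU2) : (blockRep b w U)ᴴ * blockRep b w U = 1 := by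
  rw [blockRep_conjTranspose]
  nth_rw 1 [blockRep]
  rw [Matrix.mul_assoc, ← h.Q_mul_frame', Matrix.mul_assoc, ← Matrix.mul_assoc (Q n U⁻¹), ← Q_mul,
    inv_mul_cancel, Q_one, Matrix.one_mul, h.frame_conjTranspose_mul_frame]

omit h in
lemma continuous_blockRep : Continuous (blockRep b w) :=
  (continuous_const.matrix_mul (continuous_matrix fun x y => continuous_Q x y)).matrix_mul
    continuous_const

lemma blockRep_one : blockRep b w 1 = 1 := by
  rw [blockRep, Q_one, Matrix.mul_one, h.frame_conjTranspose_mul_frame]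

lemma Q_conj_frame (U : SU2) (Y : Matrix (Fin d) (Fin d) ℂ) :
    Q n U * (frame b w * Y * (frame b w)ᴴ) * (Q n U)ᴴ =
      frame b w * (blockRep b w U * Y * (blockRep b w U)ᴴ) * (frame b w)ᴴ := by
  rw [Q_conjTranspose, blockRep_conjTranspose]
  calc _ = (Q n U * frame b w) * Y * ((frame b w)ᴴ * Q n U⁻¹) := by
        simp only [Matrix.mul_assoc]
    _ = _ := by
        rw [h.Q_mul_frame', h.frame_conjTranspose_mul_Q]
        simp only [Matrix.mul_assoc]

lemma blockChannel_conj (U : SU2) (Y : Matrix (Fin d) (Fin d) ℂ) :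
    blockChannel b w (blockRep b w U * Y * (blockRep b w U)ᴴ) =
      blockRep b w U * blockChannel b w Y * (blockRep b w U)ᴴ := by
  rw [blockChannel_apply, ← h.Q_conj_frame, channel_conj, Q_conjTranspose, blockRep_conjTranspose,
    blockChannel_apply]
  calc _ = ((frame b w)ᴴ * Q n U) * channel haarSU2 b (frame b w * Y * (frame b w)ᴴ) *
        (Q n U⁻¹ * frame b w) := by simp only [Matrix.mul_assoc]
    _ = _ := by
        rw [h.Q_mul_frame', h.frame_conjTranspose_mul_Q]
        simp only [Matrix.mul_assoc]

omit h in
lemma hs_frame_conj (Y : Matrix (Fin d) (Fin d) ℂ) (Z : Op n) :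
    hs (frame b w * Y * (frame b w)ᴴ) Z = hs Y ((frame b w)ᴴ * Z * frame b w) := by
  simp only [hs, Matrix.conjTranspose_mul, Matrix.conjTranspose_conjTranspose]
  rw [Matrix.mul_assoc, Matrix.trace_mul_comm]
  simp only [Matrix.mul_assoc]

omit h in
lemma hs_blockChannel (X Y : Matrix (Fin d) (Fin d) ℂ) : hs X (blockChannel b w Y) =
    hs (frame b w * X * (frame b w)ᴴ)
      (channel haarSU2 b (frame b w * Y * (frame b w)ᴴ)) := by
  rw [hs_frame_conj, blockChannel_apply]

omit h in
lemma hs_blockChannel_left (X Y : Matrix (Fin d) (Fin d) ℂ) :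
    hs (blockChannel b w X) Y = hs X (blockChannel b w Y) := by
  rw [← hs_conj, hs_blockChannel, hs_blockChannel, hs_conj, hs_channel_left]

/-- Outcomes in the block see a block operator through its diagonal. -/
lemma trace_frame_conj_mul_snapshot (U : SU2) (Y : Matrix (Fin d) (Fin d) ℂ) (q : Fin d) :
    (frame b w * Y * (frame b w)ᴴ * snapshot b U (w q)).trace =
      (blockRep b w U * Y * (blockRep b w U)ᴴ) q q := by
  classical
  rw [trace_mul_snapshot, h.Q_conj_frame]
  set Z := blockRep b w U * Y * (blockRep b w U)ᴴ
  have h1 : (frame b w)ᴴ *ᵥ (b (w q)).ofLp = Pi.single q 1 := by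
    ext p
    rw [frame_conjTranspose_mulVec_basis, Pi.single_apply]
    simp only [h.injective.eq_iff]
  have h2 : star (b (w q)).ofLp ᵥ* frame b w = Pi.single q 1 := by
    have h3 := congrArg star h1
    rw [Matrix.star_mulVec, Matrix.conjTranspose_conjTranspose] at h3
    rw [h3]
    ext p
    simp [Pi.single_apply]
  rw [← Matrix.mulVec_mulVec, h1, ← Matrix.mulVec_mulVec, Matrix.dotProduct_mulVec, h2,
    single_one_dotProduct, Matrix.mulVec_single_one]
  rfl

/-- Outcomes outside the block do not see a block operator. -/
lemma trace_frame_conj_mul_snapshot_of_notMem (U : SU2) (Y : Matrix (Fin d) (Fin d) ℂ) {v : ι}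
    (hv : ∀ q, w q ≠ v) : (frame b w * Y * (frame b w)ᴴ * snapshot b U v).trace = 0 := by
  classical
  have h1 : (frame b w)ᴴ *ᵥ (b v).ofLp = 0 := by
    ext p
    rw [frame_conjTranspose_mulVec_basis, if_neg (hv p), Pi.zero_apply]
  rw [trace_mul_snapshot, h.Q_conj_frame, ← Matrix.mulVec_mulVec, h1, Matrix.mulVec_zero,
    dotProduct_zero]

lemma snapshot_eq (U : SU2) (q : Fin d) : snapshot b U (w q) =
    frame b w * ((blockRep b w U)ᴴ * Matrix.single q q 1 * blockRep b w U) * (frame b w)ᴴ := by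
  have h1 : Matrix.vecMulVec (b (w q)).ofLp (star (b (w q)).ofLp) =
      frame b w * Matrix.single q q (1 : ℂ) * (frame b w)ᴴ := by
    ext x y
    rw [Matrix.mul_assoc, Matrix.mul_apply, Finset.sum_eq_single q]
    · rw [Matrix.single_mul_apply_same, one_mul]
      rfl
    · intro p _ hp
      rw [Matrix.single_mul_apply_of_ne _ _ _ _ _ hp, mul_zero]
    · simp
  rw [snapshot, h1, Q_conjTranspose, blockRep_conjTranspose]
  calc _ = (Q n U⁻¹ * frame b w) * Matrix.single q q (1 : ℂ) * ((frame b w)ᴴ * Q n U) := by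
        simp only [Matrix.mul_assoc]
    _ = _ := by
        rw [h.Q_mul_frame', h.frame_conjTranspose_mul_Q]
        simp only [Matrix.mul_assoc]

/-- The measurement channel preserves the operators on a block. -/
theorem channel_frame_conj (Y : Matrix (Fin d) (Fin d) ℂ) :
    channel haarSU2 b (frame b w * Y * (frame b w)ᴴ) =
      frame b w * blockChannel b w Y * (frame b w)ᴴ := by
  refine hs_left_injective fun Z => ?_
  -- The claim becomes that only the compression of `Z` to the block matters. Outcomes outside the
  -- block contribute nothing, and snapshots inside it have the form `V S V†`.
  have h1 : hs Z (frame b w * blockChannel b w Y * (frame b w)ᴴ) =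
      hs (frame b w * ((frame b w)ᴴ * Z * frame b w) * (frame b w)ᴴ)
        (channel haarSU2 b (frame b w * Y * (frame b w)ᴴ)) := by
    rw [← hs_conj, hs_frame_conj, hs_conj, hs_blockChannel]
  rw [h1, hs_channel, hs_channel]
  refine integral_congr_ae (Filter.Eventually.of_forall fun U => ?_)
  refine Finset.sum_congr rfl fun v _ => ?_
  by_cases hv : ∃ q, w q = v
  · obtain ⟨q, rfl⟩ := hv
    congr 1
    rw [h.snapshot_eq]
    set S := (blockRep b w U)ᴴ * Matrix.single q q 1 * blockRep b w U
    simp only [Matrix.conjTranspose_mul, Matrix.conjTranspose_conjTranspose]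
    rw [← Matrix.mul_assoc, Matrix.trace_mul_comm]
    calc _ = ((frame b w)ᴴ * Zᴴ * frame b w * S).trace := by simp only [Matrix.mul_assoc]
      _ = (((frame b w)ᴴ * frame b w) * ((frame b w)ᴴ * Zᴴ * frame b w) *
            ((frame b w)ᴴ * frame b w) * S).trace := by
          rw [h.frame_conjTranspose_mul_frame, Matrix.one_mul, Matrix.mul_one]
      _ = ((frame b w)ᴴ * (frame b w * ((frame b w)ᴴ * Zᴴ * frame b w) *
            (frame b w)ᴴ * frame b w * S)).trace := by simp only [Matrix.mul_assoc]
      _ = _ := by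
          rw [Matrix.trace_mul_comm]
          simp only [Matrix.mul_assoc]
  · push Not at hv
    rw [h.trace_frame_conj_mul_snapshot_of_notMem U Y hv, mul_zero, mul_zero]

/-- The form of the channel at a block operator is an averaged sum of squares over all outcomes.
Keeping only those of the block leaves the diagonal of the rotated matrix. -/
lemma integral_le_hs_blockChannel (Y : Matrix (Fin d) (Fin d) ℂ) :
    ∫ U, ∑ q, ‖(blockRep b w U * Y * (blockRep b w U)ᴴ) q q‖ ^ 2 ∂haarSU2 ≤
      (hs Y (blockChannel b w Y)).re := by
  classical
  set X := frame b w * Y * (frame b w)ᴴ with hX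
  have hc : ∀ v, Continuous fun U => ‖(X * snapshot b U v).trace‖ ^ 2 := fun v =>
    (continuous_trace_mul_snapshot b v X).norm.pow 2
  have h1 : hs Y (blockChannel b w Y) =
      ((∫ U, ∑ v, ‖(X * snapshot b U v).trace‖ ^ 2 ∂haarSU2 : ℝ) : ℂ) := by
    rw [hs_blockChannel, hs_channel, ← integral_complex_ofReal]
    refine integral_congr_ae (Filter.Eventually.of_forall fun U => ?_)
    push_cast
    refine Finset.sum_congr rfl fun v _ => ?_
    rw [← star_trace_mul_snapshot, Complex.star_def, Complex.conj_mul']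
  rw [h1, Complex.ofReal_re]
  simp only [← h.trace_frame_conj_mul_snapshot]
  refine integral_mono (integrable_of_continuous _ (continuous_finsetSum _ fun q _ => hc (w q)))
    (integrable_of_continuous _ (continuous_finsetSum _ fun v _ => hc v)) fun U => ?_
  change ∑ q, ‖(X * snapshot b U (w q)).trace‖ ^ 2 ≤ ∑ v, ‖(X * snapshot b U v).trace‖ ^ 2
  rw [← Finset.sum_image (s := Finset.univ) (g := w)
    (f := fun v => ‖(X * snapshot b U v).trace‖ ^ 2) h.injective.injOn]
  exact Finset.sum_le_univ_sum_of_nonneg fun v => sq_nonneg _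

/-! #### The action of the Lie algebra on a block -/

omit [Fintype ι] h in
lemma hasDerivAt_Q {γ : ℝ → SU2} {A : Matrix (Fin 2) (Fin 2) ℂ} (h0 : γ 0 = 1)
    (hγ : ∀ a c, HasDerivAt (fun θ => (γ θ).1 a c) (A a c) 0) (x y : Bits n) :
    HasDerivAt (fun θ => Q n (γ θ) x y) (collective n A x y) 0 :=
  hasDerivAt_tensorPow (γ := fun θ => (γ θ).1) (by rw [h0]; rfl) hγ x y

/-- Invariance of the block under the group says that `(1 - V V†) Q(γ θ) V` vanishes for all `θ`;
its derivative at `0` therefore vanishes as well. -/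
lemma collective_mul_frame {γ : ℝ → SU2} {A : Matrix (Fin 2) (Fin 2) ℂ} (h0 : γ 0 = 1)
    (hγ : ∀ a c, HasDerivAt (fun θ => (γ θ).1 a c) (A a c) 0) :
    collective n A * frame b w = frame b w * ((frame b w)ᴴ * collective n A * frame b w) := by
  have h1 : (1 - frame b w * (frame b w)ᴴ) * collective n A * frame b w = 0 := by
    ext x q
    refine (hasDerivAt_mul_mul (hasDerivAt_Q h0 hγ) _ _ x q).unique ?_
    have h2 : ∀ θ, (1 - frame b w * (frame b w)ᴴ) * Q n (γ θ) * frame b w = 0 := by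
      intro θ
      rw [Matrix.sub_mul, Matrix.sub_mul, Matrix.one_mul, sub_eq_zero, h.Q_mul_frame]
      simp only [Matrix.mul_assoc]
    simp only [h2]
    exact hasDerivAt_const _ _
  rw [Matrix.sub_mul, Matrix.sub_mul, Matrix.one_mul, sub_eq_zero] at h1
  rw [h1]
  simp only [Matrix.mul_assoc]

lemma blockChannel_adj {γ : ℝ → SU2} {A : Matrix (Fin 2) (Fin 2) ℂ} (h0 : γ 0 = 1)
    (hγ : ∀ a c, HasDerivAt (fun θ => (γ θ).1 a c) (A a c) 0) (hA : Aᴴ = -A)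
    (X : Matrix (Fin d) (Fin d) ℂ) :
    blockChannel b w (adj ((frame b w)ᴴ * collective n A * frame b w) X) =
      adj ((frame b w)ᴴ * collective n A * frame b w) (blockChannel b w X) := by
  refine adj_comm_of_conj_comm (γ := fun θ => blockRep b w (γ θ)) ?_
    (hasDerivAt_mul_mul (hasDerivAt_Q h0 hγ) _ _) ?_ (fun θ => h.blockChannel_conj (γ θ)) X
  · rw [h0, h.blockRep_one]
  · have h1 : collective n (-A) = -collective n A := by
      rw [← neg_one_smul ℂ A, collective_smul, neg_one_smul]
    simp only [Matrix.conjTranspose_mul, Matrix.conjTranspose_conjTranspose,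
      collective_conjTranspose, hA, h1, Matrix.mul_neg, Matrix.neg_mul, Matrix.mul_assoc]

/-- The raising operator on a block. -/
def raising (_ : IsSpinBlock b w) : Matrix (Fin d) (Fin d) ℂ :=
  (frame b w)ᴴ * Jp n * frame b w

lemma raising_conjTranspose : h.raisingᴴ = (frame b w)ᴴ * (Jp n)ᴴ * frame b w := by
  simp only [raising, Matrix.conjTranspose_mul, Matrix.conjTranspose_conjTranspose,
    Matrix.mul_assoc]

lemma Jp_mul_frame : Jp n * frame b w = frame b w * h.raising := by
  rw [raising, Jp_eq]
  simp only [Matrix.smul_mul, Matrix.add_mul, Matrix.mul_smul, Matrix.mul_add]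
  rw [h.collective_mul_frame rotY_zero hasDerivAt_rotY,
    h.collective_mul_frame rotX_zero hasDerivAt_rotX]

lemma JpH_mul_frame : (Jp n)ᴴ * frame b w = frame b w * h.raisingᴴ := by
  rw [raising_conjTranspose, Jp_conjTranspose_eq]
  simp only [Matrix.smul_mul, Matrix.sub_mul, Matrix.mul_smul, Matrix.mul_sub]
  rw [h.collective_mul_frame rotY_zero hasDerivAt_rotY,
    h.collective_mul_frame rotX_zero hasDerivAt_rotX]

lemma blockChannel_adj_raising (X : Matrix (Fin d) (Fin d) ℂ) :
    blockChannel b w (adj h.raising X) = adj h.raising (blockChannel b w X) := by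
  have hY := h.blockChannel_adj rotY_zero hasDerivAt_rotY (by
    ext i j; fin_cases i <;> fin_cases j <;> simp) X
  have hX := h.blockChannel_adj rotX_zero hasDerivAt_rotX (by
    ext i j; fin_cases i <;> fin_cases j <;> simp) X
  rw [raising, Jp_eq]
  simp only [Matrix.smul_mul, Matrix.add_mul, Matrix.mul_smul, Matrix.mul_add, adj_smul, adj_add,
    LinearMap.smul_apply, LinearMap.add_apply, map_smul, map_add, hX, hY]

lemma blockChannel_adj_raising_conjTranspose (X : Matrix (Fin d) (Fin d) ℂ) :
    blockChannel b w (adj h.raisingᴴ X) = adj h.raisingᴴ (blockChannel b w X) := by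
  have hY := h.blockChannel_adj rotY_zero hasDerivAt_rotY (by
    ext i j; fin_cases i <;> fin_cases j <;> simp) X
  have hX := h.blockChannel_adj rotX_zero hasDerivAt_rotX (by
    ext i j; fin_cases i <;> fin_cases j <;> simp) X
  rw [raising_conjTranspose, Jp_conjTranspose_eq]
  simp only [Matrix.smul_mul, Matrix.sub_mul, Matrix.mul_smul, Matrix.mul_sub, adj_smul, adj_sub,
    LinearMap.smul_apply, LinearMap.sub_apply, map_smul, map_sub, hX, hY]

lemma raising_commutator : h.raising * h.raisingᴴ - h.raisingᴴ * h.raising =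
    Matrix.diagonal fun p : Fin d => (d : ℂ) - 1 - 2 * (p : ℕ) := by
  have h1 : h.raising * h.raisingᴴ - h.raisingᴴ * h.raising =
      (frame b w)ᴴ * (Jp n * (Jp n)ᴴ - (Jp n)ᴴ * Jp n) * frame b w := by
    rw [Matrix.mul_sub, Matrix.sub_mul]
    congr 1
    · nth_rw 1 [raising]
      rw [Matrix.mul_assoc, ← h.JpH_mul_frame]
      simp only [Matrix.mul_assoc]
    · nth_rw 1 [raising_conjTranspose]
      rw [Matrix.mul_assoc, ← h.Jp_mul_frame]
      simp only [Matrix.mul_assoc]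
  rw [h1, Jp_commutator, Matrix.mul_smul, Matrix.smul_mul, Matrix.mul_assoc, h.Jz_mul_frame,
    ← Matrix.mul_assoc, h.frame_conjTranspose_mul_frame, Matrix.one_mul, ← Matrix.diagonal_smul]
  congr 1
  ext p
  simp only [Pi.smul_apply, smul_eq_mul]
  ring

/-- In the weight basis the relation `[J_z, J₊] = J₊` reads `(q - p - 1) E p q = 0`. -/
lemma raising_mem_weightSpace : h.raising ∈ weightSpace d 1 := by
  set H := Matrix.diagonal fun q : Fin d => ((d : ℂ) - 1) / 2 - (q : ℕ) with hH
  have h1 : H * h.raising - h.raising * H = h.raising := by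
    have h2 : H * h.raising = (frame b w)ᴴ * (Jz n * Jp n) * frame b w := by
      calc _ = ((frame b w)ᴴ * frame b w) * H * h.raising := by
            rw [h.frame_conjTranspose_mul_frame, Matrix.one_mul]
        _ = (frame b w)ᴴ * (frame b w * H) * h.raising := by simp only [Matrix.mul_assoc]
        _ = (frame b w)ᴴ * Jz n * (frame b w * h.raising) := by
            rw [← h.Jz_mul_frame]; simp only [Matrix.mul_assoc]
        _ = _ := by rw [← h.Jp_mul_frame]; simp only [Matrix.mul_assoc]
    have h3 : h.raising * H = (frame b w)ᴴ * (Jp n * Jz n) * frame b w := by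
      rw [raising, Matrix.mul_assoc, ← h.Jz_mul_frame]
      simp only [Matrix.mul_assoc]
    rw [h2, h3, ← Matrix.sub_mul, ← Matrix.mul_sub, Jz_commutator, raising]
  intro p q hpq
  have h2 := congrFun (congrFun h1 p) q
  rw [Matrix.sub_apply, hH, Matrix.diagonal_mul, Matrix.mul_diagonal] at h2
  have h3 : (((q : ℤ) - p - 1 : ℤ) : ℂ) * h.raising p q = 0 := by
    push_cast
    linear_combination h2
  refine (mul_eq_zero.mp h3).resolve_left fun h4 => hpq ?_
  have := Int.cast_eq_zero.mp h4
  omega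

/-- The diagonal entries of `[E, Eᴴ]` give the recursion `|E k (k+1)|² - |E (k-1) k|² = d - 1 - 2
k`, with no second term at `k = 0`; summing it gives the product. Its positivity is what makes `E`
regular. -/
lemma norm_raising_sq (k : ℕ) (hk : k + 1 < d) :
    ‖h.raising ⟨k, by omega⟩ ⟨k + 1, hk⟩‖ ^ 2 = ((k : ℝ) + 1) * ((d : ℝ) - 1 - k) := by
  have hE := h.raising_mem_weightSpace
  have hrow : ∀ (k : ℕ) (hk : k + 1 < d), (h.raising * h.raisingᴴ) ⟨k, by omega⟩ ⟨k, by omega⟩ =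
      ((‖h.raising ⟨k, by omega⟩ ⟨k + 1, hk⟩‖ ^ 2 : ℝ) : ℂ) := by
    intro k hk
    rw [Matrix.mul_apply, Finset.sum_eq_single ⟨k + 1, hk⟩]
    · rw [Matrix.conjTranspose_apply, Complex.star_def, Complex.mul_conj']
      push_cast
      rfl
    · intro r _ hr
      rw [hE _ r, zero_mul]
      intro h1
      exact hr (Fin.ext (by simp only at h1 ⊢; omega))
    · simp
  have hcom : ∀ p : Fin d, (h.raising * h.raisingᴴ) p p - (h.raisingᴴ * h.raising) p p =
      (d : ℂ) - 1 - 2 * (p : ℕ) := by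
    intro p
    rw [← Matrix.sub_apply, h.raising_commutator, Matrix.diagonal_apply_eq]
  induction k with
  | zero =>
    have h1 := hcom ⟨0, by omega⟩
    have h2 : (h.raisingᴴ * h.raising) ⟨0, by omega⟩ ⟨0, by omega⟩ = 0 := by
      rw [Matrix.mul_apply]
      refine Finset.sum_eq_zero fun r _ => ?_
      rw [hE r _ (by simp only; omega), mul_zero]
    rw [hrow 0 hk, h2] at h1
    have h3 : ‖h.raising ⟨0, by omega⟩ ⟨0 + 1, hk⟩‖ ^ 2 - 0 = (d : ℝ) - 1 - 2 * (0 : ℕ) := by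
      exact_mod_cast h1
    rw [sub_zero] at h3
    rw [h3]
    push_cast
    ring
  | succ k ih =>
    have h1 := hcom ⟨k + 1, by omega⟩
    have h2 : (h.raisingᴴ * h.raising) ⟨k + 1, by omega⟩ ⟨k + 1, by omega⟩ =
        ((‖h.raising ⟨k, by omega⟩ ⟨k + 1, by omega⟩‖ ^ 2 : ℝ) : ℂ) := by
      rw [Matrix.mul_apply, Finset.sum_eq_single ⟨k, by omega⟩]
      · rw [Matrix.conjTranspose_apply, Complex.star_def, Complex.conj_mul']
        push_cast
        rfl
      · intro r _ hr
        rw [hE r, mul_zero]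
        intro h1
        exact hr (Fin.ext (by simp only at h1 ⊢; omega))
      · simp
    rw [hrow (k + 1) hk, h2, ih (by omega) hrow] at h1
    have h3 : ‖h.raising ⟨k + 1, by omega⟩ ⟨k + 1 + 1, hk⟩‖ ^ 2 -
        ((k : ℝ) + 1) * ((d : ℝ) - 1 - k) = (d : ℝ) - 1 - 2 * ((k + 1 : ℕ) : ℝ) := by
      exact_mod_cast h1
    rw [sub_eq_iff_eq_add.mp h3]
    push_cast
    ring

lemma raising_ne_zero (p q : Fin d) (hpq : (q : ℤ) - p = 1) : h.raising p q ≠ 0 := by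
  obtain ⟨p, hp⟩ := p
  obtain ⟨q, hq⟩ := q
  obtain rfl : q = p + 1 := by simp only at hpq; omega
  intro h0
  have h1 := h.norm_raising_sq p hq
  have h2 : ((p : ℝ) + 1) < d := by exact_mod_cast hq
  rw [h0, norm_zero] at h1
  have h3 : 0 < ((p : ℝ) + 1) * ((d : ℝ) - 1 - p) := mul_pos (by positivity) (by linarith)
  rw [← h1] at h3
  norm_num at h3

/-- The smallest eigenvalue of the channel on a block of dimension `d` is at least
`1 / (2 d - 1)`. -/
theorem hs_le_hs_blockChannel (X : Matrix (Fin d) (Fin d) ℂ) :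
    (hs X X).re ≤ (2 * d - 1) ^ 2 * (hs (blockChannel b w X) (blockChannel b w X)).re :=
  hs_le_of_equivariant h.pos h.raising_mem_weightSpace h.raising_ne_zero h.raising_commutator
    hs_blockChannel_left h.blockChannel_adj_raising h.blockChannel_adj_raising_conjTranspose
    h.blockRep_unitary continuous_blockRep h.blockChannel_conj h.integral_le_hs_blockChannel X

/-- The lower bound on the norm gives injectivity, hence surjectivity in finite dimension. -/
lemma blockChannel_surjective : Function.Surjective (blockChannel b w) := by
  rw [← LinearMap.injective_iff_surjective, ← LinearMap.ker_eq_bot, LinearMap.ker_eq_bot']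
  intro X hX
  have h1 := h.hs_le_hs_blockChannel X
  have h2 : (hs X X).re ≤ 0 := by simpa [hX, hs] using h1
  ext p q
  have h3 := (norm_apply_sq_le_hs X p q).trans h2
  have h4 : ‖X p q‖ = 0 := by nlinarith [norm_nonneg (X p q)]
  exact norm_eq_zero.mp h4

end IsSpinBlock

end Block

/-! ### Statistics of the estimator -/

section Statistics

variable {n : ℕ} {ι : Type*} [Fintype ι] (b : OrthonormalBasis ι ℂ (Qubits n))

lemma sum_basis_mul_star (x y : Bits n) :
    ∑ v, b v x * star (b v y) = (1 : Op n) x y := by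
  have h := b.sum_inner_mul_inner (EuclideanSpace.single x 1) (EuclideanSpace.single y 1)
  simpa [EuclideanSpace.inner_single_left, EuclideanSpace.inner_single_right, Matrix.one_apply,
    eq_comm] using h

lemma sum_snapshot (U : SU2) : ∑ v, snapshot b U v = 1 := by
  have h : ∑ v, Matrix.vecMulVec (b v).ofLp (star (b v).ofLp) = 1 := by
    ext x y
    rw [← sum_basis_mul_star b, Matrix.sum_apply]
    rfl
  simp only [snapshot]
  rw [← Matrix.sum_mul, ← Matrix.mul_sum, h, Matrix.mul_one, Q_conjTranspose_mul_self]

variable {b}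

lemma IsState.trace_mul_snapshot_nonneg {ρ : Op n} (hρ : IsState ρ) (U : SU2) (v : ι) :
    0 ≤ (ρ * snapshot b U v).trace := by
  rw [trace_mul_snapshot]
  exact (hρ.1.mul_mul_conjTranspose_same (Q n U)).dotProduct_mulVec_nonneg _

lemma IsState.ofReal_outcomeProb {ρ : Op n} (hρ : IsState ρ) (U : SU2) (v : ι) :
    (outcomeProb b ρ U v : ℂ) = (ρ * snapshot b U v).trace :=
  (Complex.eq_re_of_ofReal_le (r := 0) (by simpa using hρ.trace_mul_snapshot_nonneg U v)).symm

lemma IsState.outcomeProb_nonneg {ρ : Op n} (hρ : IsState ρ) (U : SU2) (v : ι) :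
    0 ≤ outcomeProb b ρ U v :=
  (Complex.le_def.mp (hρ.trace_mul_snapshot_nonneg U v)).1

lemma IsState.sum_outcomeProb {ρ : Op n} (hρ : IsState ρ) (U : SU2) :
    ∑ v, outcomeProb b ρ U v = 1 := by
  have h : ((∑ v, outcomeProb b ρ U v : ℝ) : ℂ) = 1 := by
    push_cast
    simp only [hρ.ofReal_outcomeProb]
    rw [← Matrix.trace_sum, ← Matrix.mul_sum, sum_snapshot, Matrix.mul_one, hρ.2]
  exact_mod_cast h

lemma continuous_outcomeProb (ρ : Op n) (v : ι) : Continuous fun U => outcomeProb b ρ U v :=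
  Complex.continuous_re.comp (continuous_trace_mul_snapshot b v ρ)

lemma expect_eq_integral {V : Type*} [NormedAddCommGroup V] [NormedSpace ℝ V] (ν : Measure SU2)
    [IsFiniteMeasure ν] (ρ : Op n) {f : SU2 → ι → V} (hf : ∀ v, Continuous fun U => f U v) :
    expect ν b ρ f = ∫ U, ∑ v, outcomeProb b ρ U v • f U v ∂ν :=
  (integral_finsetSum Finset.univ fun v _ =>
    integrable_of_continuous ν ((continuous_outcomeProb ρ v).smul (hf v))).symm

/-- The variance of a bounded statistic is at most the square of the bound. -/
lemma IsState.expect_norm_sub_sq_le {ρ : Op n} (hρ : IsState ρ) (ν : Measure SU2)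
    [IsProbabilityMeasure ν] {f : SU2 → ι → ℂ} (hf : ∀ v, Continuous fun U => f U v) {C : ℝ}
    (hC : ∀ U v, ‖f U v‖ ^ 2 ≤ C) :
    expect ν b ρ (fun U v => ‖f U v - expect ν b ρ f‖ ^ 2) ≤ C := by
  set m := expect ν b ρ f with hm
  have hp := continuous_outcomeProb (b := b) ρ
  have hg : Continuous fun U => ∑ v, outcomeProb b ρ U v • f U v :=
    continuous_finsetSum _ fun v _ => (hp v).smul (hf v)
  have hmg : m = ∫ U, ∑ v, outcomeProb b ρ U v • f U v ∂ν :=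
    expect_eq_integral ν ρ hf
  -- The square is expanded around the mean. After integration the cross term equals `-2 ‖m‖²`,
  -- leaving `C - ‖m‖²`.
  have hpt : ∀ U, ∑ v, outcomeProb b ρ U v • ‖f U v - m‖ ^ 2 ≤
      (C + ‖m‖ ^ 2) - 2 * (star m * ∑ v, outcomeProb b ρ U v • f U v).re := by
    intro U
    have h1 : ∀ v, outcomeProb b ρ U v • ‖f U v - m‖ ^ 2 ≤
        outcomeProb b ρ U v * (C + ‖m‖ ^ 2) -
          2 * (star m * outcomeProb b ρ U v • f U v).re := by
      intro v
      have h2 : ‖f U v - m‖ ^ 2 = ‖f U v‖ ^ 2 + ‖m‖ ^ 2 - 2 * (star m * f U v).re := by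
        rw [← Complex.normSq_eq_norm_sq, ← Complex.normSq_eq_norm_sq, ← Complex.normSq_eq_norm_sq,
          Complex.normSq_sub]
        rw [mul_comm (star m)]
        rfl
      have h3 : (star m * outcomeProb b ρ U v • f U v).re =
          outcomeProb b ρ U v * (star m * f U v).re := by
        rw [mul_smul_comm, Complex.smul_re, smul_eq_mul]
      rw [h2, h3, smul_eq_mul]
      have := mul_le_mul_of_nonneg_left (hC U v) (hρ.outcomeProb_nonneg (b := b) U v)
      linarith
    refine (Finset.sum_le_sum fun v _ => h1 v).trans (le_of_eq ?_)
    rw [Finset.sum_sub_distrib, ← Finset.sum_mul, hρ.sum_outcomeProb, one_mul, ← Finset.mul_sum,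
      ← Complex.re_sum, ← Finset.mul_sum]
  have hre : ∫ U, (star m * ∑ v, outcomeProb b ρ U v • f U v).re ∂ν = ‖m‖ ^ 2 := by
    have h1 := integral_re (𝕜 := ℂ) (integrable_of_continuous ν (continuous_const.mul hg) :
      Integrable (fun U => star m * ∑ v, outcomeProb b ρ U v • f U v) ν)
    refine h1.trans ?_
    rw [integral_const_mul, ← hmg, Complex.star_def, Complex.conj_mul']
    norm_cast
  have hcont : Continuous fun U => (star m * ∑ v, outcomeProb b ρ U v • f U v).re :=
    Complex.continuous_re.comp (continuous_const.mul hg)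
  calc expect ν b ρ (fun U v => ‖f U v - m‖ ^ 2)
      = ∫ U, ∑ v, outcomeProb b ρ U v • ‖f U v - m‖ ^ 2 ∂ν :=
        expect_eq_integral ν ρ fun v => ((hf v).sub continuous_const).norm.pow 2
    _ ≤ ∫ U, ((C + ‖m‖ ^ 2) - 2 * (star m * ∑ v, outcomeProb b ρ U v • f U v).re) ∂ν :=
        integral_mono (integrable_of_continuous ν (continuous_finsetSum _ fun v _ =>
          (hp v).smul (((hf v).sub continuous_const).norm.pow 2)))
          (integrable_of_continuous ν (continuous_const.sub (continuous_const.mul hcont))) hpt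
    _ = C - ‖m‖ ^ 2 := by
        have hcont' : Continuous fun U =>
            2 * (star m * ∑ v, outcomeProb b ρ U v • f U v).re := continuous_const.mul hcont
        rw [integral_sub (integrable_const _) (integrable_of_continuous ν hcont'),
          integral_const_mul, hre, integral_const, probReal_univ, one_smul]
        ring
    _ ≤ C := by linarith [sq_nonneg ‖m‖]

/-- The estimator of an operator in the image of the channel. -/
lemma estimator_eq (ν : Measure SU2) [IsFiniteMeasure ν] {O Y : Op n} (hY : channel ν b Y = O)
    {U : SU2} {v : ι} (hS : snapshot b U v ∈ visibleSpace ν b) :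
    estimator ν b O U v = (Y * snapshot b U v).trace := by
  obtain ⟨Z, hZ⟩ := hS
  -- On the range of the channel the pseudoinverse is a right inverse. Self-adjointness then moves
  -- the channel off `Y`, where it produced `O`, onto `pinv` of the snapshot.
  have h1 : channel ν b (pinv (channel ν b) (snapshot b U v)) = snapshot b U v := by
    rw [← hZ, (pinv_spec _).left]
  calc estimator ν b O U v = hs Oᴴ (pinv (channel ν b) (snapshot b U v)) := by
        rw [estimator, Matrix.trace_mul_comm, hs, Matrix.conjTranspose_conjTranspose]
    _ = hs Yᴴ (snapshot b U v) := by
        rw [← hY, ← channel_conjTranspose, hs_channel_left, h1]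
    _ = _ := by rw [hs, Matrix.conjTranspose_conjTranspose]

/-- The outcome probability is itself `Tr[ρ S]` for the snapshot `S`, so the expectation is the form
of the channel at `(ρ, Y)`. -/
lemma IsState.expect_trace_mul_snapshot (ν : Measure SU2) [IsFiniteMeasure ν] {ρ : Op n}
    (hρ : IsState ρ) (Y : Op n) :
    expect ν b ρ (fun U v => (Y * snapshot b U v).trace) = (ρ * channel ν b Y).trace := by
  have h1 : (ρ * channel ν b Y).trace = hs ρ (channel ν b Y) := by
    rw [hs, hρ.1.isHermitian.eq]
  rw [h1, hs_channel, hρ.1.isHermitian.eq,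
    expect_eq_integral ν ρ fun v => continuous_trace_mul_snapshot b v Y]
  refine integral_congr_ae (Filter.Eventually.of_forall fun U => ?_)
  simp only [Complex.real_smul, hρ.ofReal_outcomeProb]

end Statistics

/-! ### Permutation-invariant operators in a Schur basis -/

section Schur

variable {n d : ℕ} {ι : Type*} [Fintype ι] {b : OrthonormalBasis ι ℂ (Qubits n)}

/-- Each of the `d` columns lists coefficients of `O b(w q)` in an orthonormal family, so Bessel's
inequality bounds it by `‖O‖²`. -/
lemma hs_compression_le {w : Fin d → ι} (hw : Function.Injective w) (O : Op n) :
    (hs ((frame b w)ᴴ * O * frame b w) ((frame b w)ᴴ * O * frame b w)).re ≤ d * opNorm O ^ 2 := by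
  rw [hs_self_eq, Complex.ofReal_re]
  have h1 : ∀ q, ∑ p, ‖((frame b w)ᴴ * O * frame b w) p q‖ ^ 2 ≤ opNorm O ^ 2 := by
    intro q
    set x : Qubits n := Matrix.toEuclideanCLM (𝕜 := ℂ) O (b (w q)) with hx
    have h2 : ∀ p, ((frame b w)ᴴ * O * frame b w) p q = inner ℂ (b (w p)) x := by
      intro p
      rw [Matrix.mul_assoc, EuclideanSpace.inner_eq_star_dotProduct, dotProduct_comm, hx,
        Matrix.ofLp_toEuclideanCLM]
      rfl
    simp only [h2]
    refine ((b.orthonormal.comp w hw).sum_inner_products_le x (s := Finset.univ)).trans ?_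
    refine pow_le_pow_left₀ (norm_nonneg _) ?_ 2
    refine (ContinuousLinearMap.le_opNorm _ _).trans ?_
    rw [b.orthonormal.1, mul_one]
    exact le_rfl
  refine (Finset.sum_le_sum fun q _ => h1 q).trans ?_
  simp

/-- The projection onto an invariant block commutes with the whole group, so Schur–Weyl duality
applies to it. -/
lemma IsSpinBlock.commute_frame {w : Fin d → ι} (h : IsSpinBlock b w) {O : Op n}
    (hO : IsPermInvariant O) : Commute (frame b w * (frame b w)ᴴ) O := by
  refine commute_of_commute_Q (fun U => ?_) hO
  rw [Commute, SemiconjBy, Matrix.mul_assoc, h.frame_conjTranspose_mul_Q, ← Matrix.mul_assoc,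
    ← Matrix.mul_assoc, h.Q_mul_frame']

/-- A block operator seen through an outcome of the block is bounded by its Hilbert–Schmidt norm. -/
lemma IsSpinBlock.norm_trace_mul_snapshot_sq_le {w : Fin d → ι} (h : IsSpinBlock b w)
    {O : Op n} {Y : Matrix (Fin d) (Fin d) ℂ}
    (hY : blockChannel b w Y = (frame b w)ᴴ * O * frame b w) (U : SU2) (q : Fin d) :
    ‖(frame b w * Y * (frame b w)ᴴ * snapshot b U (w q)).trace‖ ^ 2 ≤
      (2 * d - 1) ^ 2 * (d * opNorm O ^ 2) := by
  rw [h.trace_frame_conj_mul_snapshot]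
  -- A single entry is bounded by the Hilbert–Schmidt norm, which conjugation by the unitary
  -- `blockRep` leaves unchanged.
  refine (norm_apply_sq_le_hs _ q q).trans ?_
  rw [hs_conj_isometry (h.blockRep_unitary U)]
  refine (h.hs_le_hs_blockChannel Y).trans ?_
  rw [hY]
  exact mul_le_mul_of_nonneg_left (hs_compression_le h.injective O) (sq_nonneg _)

variable {T : Fin (n / 2 + 1) → Type} [∀ k, Fintype (T k)]

/-- The labels of the copy `t` of the irreducible representation `k`. -/
def blockLabel (k : Fin (n / 2 + 1)) (t : T k) (q : Fin (n - 2 * k.1 + 1)) : SchurIndex n T :=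
  ⟨k, q, t⟩

omit [∀ k, Fintype (T k)] in
lemma blockLabel_injective (k : Fin (n / 2 + 1)) (t : T k) :
    Function.Injective (blockLabel k t) := by
  intro p q h
  simpa [blockLabel] using h

variable {b : OrthonormalBasis (SchurIndex n T) ℂ (Qubits n)}

lemma mul_frame_apply {ι : Type*} [Fintype ι] (b : OrthonormalBasis ι ℂ (Qubits n))
    (w : Fin d → ι) (A : Op n) (x : Bits n) (q : Fin d) :
    (A * frame b w) x q = (Matrix.toEuclideanCLM (𝕜 := ℂ) A (b (w q))) x := by
  rw [Matrix.ofLp_toEuclideanCLM]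
  rfl

lemma IsSchurBasis.isSpinBlock (hb : IsSchurBasis n T b) (k : Fin (n / 2 + 1)) (t : T k) :
    IsSpinBlock b (blockLabel k t) where
  pos := Nat.succ_pos _
  injective := blockLabel_injective k t
  Q_mul_frame U := by
    obtain ⟨D, hD⟩ := hb.tensor_action
    have h1 : Q n U * frame b (blockLabel k t) = frame b (blockLabel k t) * D k U := by
      ext x q
      rw [mul_frame_apply, blockLabel, hD, Matrix.mul_apply]
      simp only [WithLp.ofLp_sum, Finset.sum_apply, WithLp.ofLp_smul, Pi.smul_apply, smul_eq_mul]
      exact Finset.sum_congr rfl fun q' _ => mul_comm _ _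
    rw [Matrix.mul_assoc, h1, ← Matrix.mul_assoc (_ᴴ),
      frame_conjTranspose_mul_frame b (blockLabel_injective k t), Matrix.one_mul]
  Jz_mul_frame := by
    ext x q
    -- This makes `n - 2 k` a genuine subtraction, so that the highest weight `(d - 1) / 2` is the
    -- spin `(n - 2 k) / 2`.
    have hk : 2 * (k : ℕ) ≤ n := by have := k.2; omega
    have hd : ((n - 2 * k.1 + 1 : ℕ) : ℂ) - 1 = n - 2 * (k : ℕ) := by
      push_cast [Nat.cast_sub hk]
      ring
    rw [mul_frame_apply, blockLabel, hb.weight, Matrix.mul_diagonal, hd]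
    simp only [WithLp.ofLp_smul, Pi.smul_apply, smul_eq_mul]
    exact mul_comm _ _

lemma sum_frame_mul_conjTranspose (b : OrthonormalBasis (SchurIndex n T) ℂ (Qubits n)) :
    ∑ k, ∑ t, frame b (blockLabel k t) * (frame b (blockLabel k t))ᴴ = 1 := by
  ext x y
  rw [← sum_basis_mul_star b, Fintype.sum_sigma, Matrix.sum_apply]
  refine Finset.sum_congr rfl fun k _ => ?_
  rw [Fintype.sum_prod_type_right, Matrix.sum_apply]
  exact Finset.sum_congr rfl fun t _ => rfl

/-- Permutation-invariant operators are images under the channel of operators which are seen through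
the outcomes with bounded values. -/
theorem IsSchurBasis.exists_channel_eq (hb : IsSchurBasis n T b) {O : Op n}
    (hO : IsPermInvariant O) : ∃ Y, channel haarSU2 b Y = O ∧
      ∀ U v, ‖(Y * snapshot b U v).trace‖ ^ 2 ≤
        (2 * n + 1) ^ 2 * ((n + 1) * opNorm O ^ 2) := by
  choose Y hY using fun k t => (hb.isSpinBlock k t).blockChannel_surjective
    ((frame b (blockLabel k t))ᴴ * O * frame b (blockLabel k t))
  refine ⟨∑ k, ∑ t, frame b (blockLabel k t) * Y k t * (frame b (blockLabel k t))ᴴ, ?_, ?_⟩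
  · simp only [map_sum, (hb.isSpinBlock _ _).channel_frame_conj, hY]
    -- Since `O` commutes with each `V V†`, its compression `V V† O V V†` equals `V V† O`, and the
    -- projections `V V†` add up to the identity.
    calc _ = ∑ k, ∑ t, (frame b (blockLabel k t) * (frame b (blockLabel k t))ᴴ) * O := by
          refine Finset.sum_congr rfl fun k _ => Finset.sum_congr rfl fun t _ => ?_
          have h := hb.isSpinBlock k t
          have h1 := (h.commute_frame hO).eq
          calc _ = frame b (blockLabel k t) * (frame b (blockLabel k t))ᴴ *
                (O * (frame b (blockLabel k t) * (frame b (blockLabel k t))ᴴ)) := by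
                simp only [Matrix.mul_assoc]
            _ = frame b (blockLabel k t) * (frame b (blockLabel k t))ᴴ *
                (frame b (blockLabel k t) * (frame b (blockLabel k t))ᴴ * O) := by rw [h1]
            _ = frame b (blockLabel k t) * ((frame b (blockLabel k t))ᴴ *
                frame b (blockLabel k t)) * (frame b (blockLabel k t))ᴴ * O := by
                simp only [Matrix.mul_assoc]
            _ = _ := by rw [h.frame_conjTranspose_mul_frame, Matrix.mul_one]
      _ = O := by
          simp only [← Matrix.sum_mul]
          rw [sum_frame_mul_conjTranspose, Matrix.one_mul]
  · rintro U ⟨k, q, t⟩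
    -- The outcome `(k, q, t)` selects the one summand of `Y` living on its own block.
    have h1 : ((∑ k, ∑ t, frame b (blockLabel k t) * Y k t * (frame b (blockLabel k t))ᴴ) *
        snapshot b U ⟨k, q, t⟩).trace = (frame b (blockLabel k t) * Y k t *
          (frame b (blockLabel k t))ᴴ * snapshot b U (blockLabel k t q)).trace := by
      simp only [Matrix.sum_mul, Matrix.trace_sum]
      rw [Finset.sum_eq_single k, Finset.sum_eq_single t]
      · rfl
      · intro t' _ ht'
        refine (hb.isSpinBlock k t').trace_frame_conj_mul_snapshot_of_notMem U _ fun q' h => ?_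
        simp only [blockLabel, Sigma.mk.injEq, heq_eq_eq, true_and, Prod.mk.injEq] at h
        exact ht' h.2
      · simp
      · intro k' _ hk'
        refine Finset.sum_eq_zero fun t' _ => ?_
        refine (hb.isSpinBlock k' t').trace_frame_conj_mul_snapshot_of_notMem U _ fun q' h => ?_
        exact hk' (congrArg Sigma.fst h)
      · simp
    rw [h1]
    refine ((hb.isSpinBlock k t).norm_trace_mul_snapshot_sq_le (hY k t) U q).trans ?_
    have hd : ((n - 2 * k.1 + 1 : ℕ) : ℝ) ≤ n + 1 := by
      exact_mod_cast Nat.succ_le_succ (Nat.sub_le _ _)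
    have hd1 : (1 : ℝ) ≤ ((n - 2 * k.1 + 1 : ℕ) : ℝ) := by
      exact_mod_cast Nat.succ_le_succ (Nat.zero_le _)
    gcongr
    · linarith
    · linarith

/-- A snapshot is an operator on the block of its outcome, and the channel maps the operators of a
block onto themselves. -/
lemma IsSchurBasis.snapshot_mem_range (hb : IsSchurBasis n T b) (U : SU2) (v : SchurIndex n T) :
    snapshot b U v ∈ LinearMap.range (channel haarSU2 b) := by
  obtain ⟨k, q, t⟩ := v
  have h := hb.isSpinBlock k t
  obtain ⟨Y, hY⟩ := h.blockChannel_surjective ((blockRep b (blockLabel k t) U)ᴴ *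
    Matrix.single q q 1 * blockRep b (blockLabel k t) U)
  exact ⟨_, (h.channel_frame_conj Y).trans (by rw [hY]; exact (h.snapshot_eq U q).symm)⟩

end Schur

end

end SU2Shadows

/-! ### The main theorem -/

open SU2Shadows in
theorem theorem3 (n : ℕ)
    (T : Fin (n / 2 + 1) → Type) [∀ k, Fintype (T k)]
    (b : OrthonormalBasis (SchurIndex n T) ℂ (Qubits n)) (hb : IsSchurBasis n T b)
    (ν : MeasureTheory.Measure SU2) [MeasureTheory.IsProbabilityMeasure ν]
    (hν : IsThreeDesign n ν)
    (O : Op n) (hO : IsPermInvariant O) :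
    O ∈ visibleSpace ν b ∧
    ∀ ρ : Op n, IsState ρ →
      expect ν b ρ (estimator ν b O) = (ρ * O).trace ∧
      estimatorVariance ν b ρ O ≤ 4 / 3 * ((n : ℝ) + 1) ^ 4 * opNorm O ^ 2 := by
  obtain ⟨Y, hY, hbound⟩ := hb.exists_channel_eq hO
  rw [← hν.channel_eq b] at hY
  have hest : estimator ν b O = fun U v => (Y * snapshot b U v).trace := by
    ext U v
    refine estimator_eq ν hY ?_
    rw [visibleSpace, hν.channel_eq b]
    exact hb.snapshot_mem_range U v
  refine ⟨⟨Y, hY⟩, fun ρ hρ => ⟨?_, ?_⟩⟩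
  · rw [hest, hρ.expect_trace_mul_snapshot ν, hY]
  · rw [estimatorVariance, hest]
    refine (hρ.expect_norm_sub_sq_le ν (fun v => continuous_trace_mul_snapshot b v Y)
      hbound).trans ?_
    -- The difference of the two sides is `4 n³ + 1`. Multiplied by `(n + 1) ‖O‖²`, this turns the
    -- bound `(2 n + 1)² (n + 1) ‖O‖²` into the stated one.
    have h1 : 3 * (2 * (n : ℝ) + 1) ^ 2 ≤ 4 * ((n : ℝ) + 1) ^ 3 := by
      rcases n with _ | _ | n
      · norm_num
      · norm_num
      · push_cast
        have : (0 : ℝ) ≤ n := Nat.cast_nonneg n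
        nlinarith [pow_nonneg this 3, pow_nonneg this 2]
    have h2 : 0 ≤ ((n : ℝ) + 1) * opNorm O ^ 2 := by positivity
    have h3 := mul_le_mul_of_nonneg_right h1 h2
    linarith
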